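/- Let $S\subset\mathbb{C}$ be a plane domain (a non-empty connected open set). Let $Bel(S)=L^\infty(S)$ be the Banach space of Beltrami differentials on $S$, and let $Q(S)$ be the space of holomorphic functions $\varphi$ on $S$ with $\iint_S|\varphi|\,dx\,dy<\infty$. Call $\mu,\nu\in Bel(S)$ infinitesimally equivalent if $\iint_S(\mu-\nu)\varphi\,dx\,dy=0$ for all $\varphi\in Q(S)$; let $Z(S)$ be the quotient space of equivalence classes $[\mu]$, with norm $\|[\mu]\|=\inf\{\|\nu\|_\infty:\nu\in[\mu]\}$. An element $\eta\in[\mu]$ is an extremal in $[\mu]$ if $\|\eta\|_\infty=\|[\mu]\|$. For $p\in S$ put $$\sigma(\eta,p)=\inf\{\operatorname{ess\,sup}_{z\in U}|\eta(z)|: U\subset S\text{ open},\ p\in U\},\qquad \sigma([\mu],p)=\inf\{\sigma(\eta,p):\eta\text{ an extremal in }[\mu]\},$$ and let $LS([\mu])=\{p\in S:\sigma([\mu],p)<\|[\mu]\|\}$ be the landslide set of $[\mu]$. Theorem. Let $[\mu]\in Z(S)$ and let $D$ be a connected component of $LS([\mu])$. Then $D$ has no holes in $S$: no bounded connected component of $\mathbb{C}\setminus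 D$ is contained in $S$. In particular, if $S$ is simply connected, then $D$ is simply connected. -/

import Mathlib

open MeasureTheory
open scoped ENNReal

noncomputable section

/-- Beltrami differentials on `S`: the complex Banach space `L^∞(S)` for planar Lebesgue measure,
with the essential supremum norm. -/
abbrev Bel (S : Set ℂ) : Type :=
  Lp ℂ ∞ ((volume : Measure ℂ).restrict S)

/-- `Q(S)`: the integrable holomorphic quadratic differentials `φ(z) dz²` on `S`. Only the values
of `φ` on `S` matter. -/
def IsQuadDiff (S : Set ℂ) (φ : ℂ → ℂ) : Prop :=
  DifferentiableOn ℂ φ S ∧ IntegrableOn φ S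

/-- For a Beltrami differential `μ` and `φ ∈ Q(S)`, the product `μ φ` is integrable on `S`. -/
theorem Bel.integrable_mul {S : Set ℂ} (μ : Bel S) {φ : ℂ → ℂ} (hφ : IsQuadDiff S φ) :
    Integrable (fun z => μ z * φ z) ((volume : Measure ℂ).restrict S) :=
  MemLp.integrable_mul (p := ∞) (q := 1) (Lp.memLp μ) (memLp_one_iff_integrable.2 hφ.2)

/-- `N(S)`: the Beltrami differentials infinitesimally equivalent to `0`, that is, those that
annihilate `Q(S)`. Two Beltrami differentials are infinitesimally equivalent when their
difference lies in `N(S)`. -/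
def infTrivial (S : Set ℂ) : Submodule ℂ (Bel S) where
  carrier := {μ | ∀ φ : ℂ → ℂ, IsQuadDiff S φ → ∫ z in S, μ z * φ z = 0}
  zero_mem' := by
    intro φ _
    rw [integral_congr_ae (g := fun _ => (0 : ℂ))]
    · simp
    · filter_upwards [Lp.coeFn_zero ℂ ∞ ((volume : Measure ℂ).restrict S)] with z hz
      rw [hz]; simp
  add_mem' := by
    intro μ ν hμ hν φ hφ
    rw [integral_congr_ae (g := fun z => μ z * φ z + ν z * φ z),
      integral_add (μ.integrable_mul hφ) (ν.integrable_mul hφ), hμ φ hφ, hν φ hφ, add_zero]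
    filter_upwards [Lp.coeFn_add μ ν] with z hz
    rw [hz, Pi.add_apply, add_mul]
  smul_mem' := by
    intro c μ hμ φ hφ
    rw [integral_congr_ae (g := fun z => c * (μ z * φ z)), integral_const_mul, hμ φ hφ, mul_zero]
    filter_upwards [Lp.coeFn_smul c μ] with z hz
    rw [hz, Pi.smul_apply, smul_eq_mul, mul_assoc]

/-- `Z(S)`: the space of infinitesimal equivalence classes of Beltrami differentials, with the
quotient norm `‖τ‖ = inf {‖ν‖_∞ : ν ∈ τ}`. -/
abbrev InfTeich (S : Set ℂ) : Type :=
  Bel S ⧸ infTrivial S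

/-- `η` is an extremal in the class `τ`: it represents `τ` and has norm `‖τ‖`. -/
def IsExtremalIn {S : Set ℂ} (η : Bel S) (τ : InfTeich S) : Prop :=
  Submodule.Quotient.mk η = τ ∧ ‖η‖ = ‖τ‖

/-- The local dilatation `σ(μ, p)` of a Beltrami differential: the infimum of the essential
suprema of `|μ|` over the open neighbourhoods of `p` in `S`. -/
def localDil {S : Set ℂ} (μ : Bel S) (p : ℂ) : ℝ≥0∞ :=
  ⨅ (U : Set ℂ) (_ : IsOpen U ∧ p ∈ U ∧ U ⊆ S),
    essSup (fun z => ‖μ z‖ₑ) ((volume : Measure ℂ).restrict U)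

/-- The local dilatation `σ(τ, p)` of a class: the infimum of `σ(η, p)` over the extremals `η`
in `τ`. -/
def classLocalDil {S : Set ℂ} (τ : InfTeich S) (p : ℂ) : ℝ≥0∞ :=
  ⨅ (η : Bel S) (_ : IsExtremalIn η τ), localDil η p

/-- The landslide set `LS(τ)` of a class: the points of `S` at which the local dilatation of `τ`
is less than the norm of `τ`. -/
def landslideSet {S : Set ℂ} (τ : InfTeich S) : Set ℂ :=
  {p | p ∈ S ∧ classLocalDil τ p < ENNReal.ofReal ‖τ‖}

/-- `D` is a connected component of the set `E`. -/
def IsComponentOf {X : Type*} [TopologicalSpace X] (D E : Set X) : Prop :=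
  ∃ p ∈ E, D = connectedComponentIn E p

/-- `H` is a hole of the plane set `D`: a bounded connected component of the complement. -/
def IsHole (H D : Set ℂ) : Prop :=
  IsComponentOf H Dᶜ ∧ Bornology.IsBounded H

end

section

open Complex Set

/-! ### The ∂̄ operator, the Cauchy–Pompeiu formula and the Cauchy transform -/

/-- The Wirtinger derivative `∂f/∂z̄`. -/
noncomputable def dbar (f : ℂ → ℂ) (w : ℂ) : ℂ := (fderiv ℝ f w 1 + I * fderiv ℝ f w I) / 2

theorem continuous_dbar {f : ℂ → ℂ} (hf : ContDiff ℝ 1 f) : Continuous (dbar f) := by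
  have hfd : Continuous (fderiv ℝ f) := hf.continuous_fderiv one_ne_zero
  unfold dbar; fun_prop

theorem hasCompactSupport_dbar {f : ℂ → ℂ} (hs : HasCompactSupport f) :
    HasCompactSupport (dbar f) := by
  refine (hs.fderiv (𝕜 := ℝ)).mono fun w hw h => hw ?_
  simp [dbar, h]

theorem hasCompactSupport_ofReal_comp {χ : ℂ → ℝ} (hχ : HasCompactSupport χ) :
    HasCompactSupport fun z => (χ z : ℂ) :=
  hχ.comp_left (g := fun x : ℝ => (x : ℂ)) ofReal_zero

/-- This is ∂̄ in polar form: up to a rotation, 2∂̄ is the radial derivative plus I times the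
derivative in the perpendicular direction. -/
theorem two_mul_dbar_mul_conj (f : ℂ → ℂ) (w : ℂ) (θ : ℝ) :
    2 * (dbar f w * exp (-(θ * I))) =
      fderiv ℝ f w (exp (θ * I)) + I * fderiv ℝ f w (I * exp (θ * I)) := by
  have h1 : exp (θ * I) = Real.cos θ • (1 : ℂ) + Real.sin θ • I := by
    rw [exp_mul_I]; simp
  have h2 : I * exp (θ * I) = (-Real.sin θ) • (1 : ℂ) + Real.cos θ • I := by
    rw [h1]; simp only [real_smul]; push_cast; linear_combination (sin (θ : ℂ)) * I_sq
  have h3 : exp (-(θ * I)) = Real.cos θ - Real.sin θ * I := by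
    rw [← neg_mul, exp_mul_I]; simp [sub_eq_add_neg]
  rw [h2, h1, map_add, map_add, map_smul, map_smul, map_smul, map_smul, h3, dbar]
  simp only [real_smul]
  push_cast
  linear_combination (-(sin (θ : ℂ)) * fderiv ℝ f w I) * I_sq

theorem integrableOn_polar_target {h : ℝ × ℝ → ℂ} (hc : Continuous h) {R : ℝ}
    (hR : ∀ p : ℝ × ℝ, R < p.1 → h p = 0) :
    IntegrableOn h (Ioi (0 : ℝ) ×ˢ Ioo (-Real.pi) Real.pi) := by
  have hK : IntegrableOn h (Icc (0 : ℝ) R ×ˢ Icc (-Real.pi) Real.pi) :=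
    hc.continuousOn.integrableOn_compact (isCompact_Icc.prod isCompact_Icc)
  refine hK.of_forall_sdiff_eq_zero (measurableSet_Ioi.prod measurableSet_Ioo) ?_
  rintro ⟨r, θ⟩ ⟨⟨h1, h2⟩, h3⟩
  refine hR _ ?_
  by_contra hlt
  exact h3 ⟨⟨(mem_Ioi.1 h1).le, not_lt.1 hlt⟩, ⟨h2.1.le, h2.2.le⟩⟩

/-- In polar coordinates the Jacobian r cancels the pole. The radial derivative integrates to -f(0)
along each ray, and the angular derivative integrates to zero over each circle by periodicity. -/
theorem integral_dbar_div {f : ℂ → ℂ} (hf : ContDiff ℝ 1 f) (hs : HasCompactSupport f) :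
    ∫ w, dbar f w / w = -(Real.pi * f 0) := by
  have hfd : Continuous (fderiv ℝ f) := hf.continuous_fderiv one_ne_zero
  have hdf : Differentiable ℝ f := hf.differentiable one_ne_zero
  obtain ⟨R, hRpos, hR⟩ : ∃ R : ℝ, 0 < R ∧ ∀ w : ℂ, R < ‖w‖ → fderiv ℝ f w = 0 := by
    obtain ⟨R, hRp, hR⟩ := (hs.fderiv (𝕜 := ℝ)).isCompact.isBounded.exists_pos_norm_le
    refine ⟨R, hRp, fun w hw => ?_⟩
    by_contra hne
    exact absurd (hR w (subset_tsupport _ hne)) (not_le.2 hw)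
  set P : ℝ × ℝ → ℂ := fun p => p.1 * exp (p.2 * I)
  have hPc : Continuous P := by fun_prop
  have hPn : ∀ p : ℝ × ℝ, R < p.1 → fderiv ℝ f (P p) = 0 := fun p hp => hR _ (by
    simp only [P, norm_mul, norm_exp_ofReal_mul_I, mul_one, norm_real]
    exact lt_of_lt_of_le hp (le_abs_self _))
  set h₁ : ℝ × ℝ → ℂ := fun p => fderiv ℝ f (P p) (exp (p.2 * I))
  set h₂ : ℝ × ℝ → ℂ := fun p => fderiv ℝ f (P p) (I * exp (p.2 * I))
  have hfP : Continuous fun p => fderiv ℝ f (P p) := hfd.comp hPc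
  have h₁c : Continuous h₁ := hfP.clm_apply (by fun_prop)
  have h₂c : Continuous h₂ := hfP.clm_apply (by fun_prop)
  have h₁i := integrableOn_polar_target h₁c (R := R) (fun p hp => by simp [h₁, hPn p hp])
  have h₂i := integrableOn_polar_target h₂c (R := R) (fun p hp => by simp [h₂, hPn p hp])
  have e₁ : ∫ p in Ioi (0 : ℝ) ×ˢ Ioo (-Real.pi) Real.pi, h₁ p = -(2 * Real.pi * f 0) := by
    rw [Measure.volume_eq_prod] at h₁i ⊢
    rw [← Measure.prod_restrict, ← integral_prod_swap, integral_prod]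
    swap
    · exact (integrable_swap_iff).2 (by rw [IntegrableOn, ← Measure.prod_restrict] at h₁i; exact h₁i)
    have inner : ∀ θ : ℝ, ∫ r in Ioi (0 : ℝ), h₁ (r, θ) = - f 0 := by
      intro θ
      set g : ℝ → ℂ := fun r => f (r * exp (θ * I))
      have hg : ∀ r, HasDerivAt g (h₁ (r, θ)) r := by
        intro r
        have : HasDerivAt (fun r : ℝ => (r : ℂ) * exp (θ * I)) (exp (θ * I)) r := by
          simpa using (hasDerivAt_id r).ofReal_comp.mul_const (exp (θ * I))
        exact (hdf _).hasFDerivAt.comp_hasDerivAt r this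
      have hgd : deriv g = fun r => h₁ (r, θ) := funext fun r => (hg r).deriv
      have hgC : ContDiff ℝ 1 g := by
        refine hf.comp (ContDiff.mul ofRealCLM.contDiff contDiff_const)
      have hgs : HasCompactSupport g := by
        refine hs.comp_isClosedEmbedding (g := fun r : ℝ => (r : ℂ) * exp (θ * I)) ?_
        refine Isometry.isClosedEmbedding (Isometry.of_dist_eq fun a b => ?_)
        rw [dist_eq_norm, dist_eq_norm, ← sub_mul, norm_mul, norm_exp_ofReal_mul_I, mul_one,
          ← ofReal_sub, norm_real]
      have := HasCompactSupport.integral_Ioi_deriv_eq hgC hgs 0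
      rw [hgd] at this
      simpa [g] using this
    simp only [Prod.swap_prod_mk, inner]
    rw [integral_const]
    rw [measureReal_restrict_apply_univ, Real.volume_real_Ioo_of_le (by linarith [Real.pi_pos]),
      real_smul]
    push_cast; ring
  have e₂ : ∫ p in Ioi (0 : ℝ) ×ˢ Ioo (-Real.pi) Real.pi, h₂ p = 0 := by
    rw [Measure.volume_eq_prod] at h₂i ⊢
    rw [← Measure.prod_restrict, integral_prod]
    swap
    · rw [IntegrableOn, ← Measure.prod_restrict] at h₂i; exact h₂i
    refine setIntegral_eq_zero_of_forall_eq_zero fun r hr => ?_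
    have hr0 : (r : ℂ) ≠ 0 := by exact_mod_cast (mem_Ioi.1 hr).ne'
    have hg : ∀ θ : ℝ, HasDerivAt (fun θ : ℝ => (r : ℂ)⁻¹ * f (r * exp (θ * I))) (h₂ (r, θ)) θ := by
      intro θ
      have h0 : HasDerivAt (fun θ : ℝ => exp (θ * I)) (exp (θ * I) * I) θ := by
        simpa using ((hasDerivAt_id θ).ofReal_comp.mul_const I).cexp
      have h1 : HasDerivAt (fun θ : ℝ => (r : ℂ) * exp (θ * I)) (r • (I * exp (θ * I))) θ := by
        refine (h0.const_mul (r : ℂ)).congr_deriv ?_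
        rw [real_smul]; ring
      have h2 := ((hdf _).hasFDerivAt.comp_hasDerivAt θ h1).const_mul (r : ℂ)⁻¹
      refine h2.congr_deriv ?_
      rw [map_smul, real_smul, ← mul_assoc, inv_mul_cancel₀ hr0, one_mul]
    rw [← integral_Ioc_eq_integral_Ioo, ← intervalIntegral.integral_of_le (by linarith [Real.pi_pos]),
      intervalIntegral.integral_eq_sub_of_hasDerivAt (fun θ _ => hg θ)]
    · simp [exp_neg, exp_pi_mul_I]
    · exact (h₂c.comp (by fun_prop : Continuous fun θ : ℝ => (r, θ))).intervalIntegrable _ _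
  rw [← Complex.integral_comp_polarCoord_symm, polarCoord_target]
  have key : ∀ p ∈ Ioi (0 : ℝ) ×ˢ Ioo (-Real.pi) Real.pi,
      p.1 • (dbar f (Complex.polarCoord.symm p) / Complex.polarCoord.symm p) =
        (1 / 2 : ℂ) * (h₁ p + I * h₂ p) := by
    rintro ⟨r, θ⟩ ⟨hr, -⟩
    have hr0 : (r : ℂ) ≠ 0 := by exact_mod_cast (mem_Ioi.1 hr).ne'
    have hP : Complex.polarCoord.symm (r, θ) = P (r, θ) := by
      simp [P, exp_mul_I]
    rw [hP]
    have := two_mul_dbar_mul_conj f (P (r, θ)) θ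
    simp only [h₁, h₂]
    rw [← this, real_smul, exp_neg]
    simp only [P]
    have := exp_ne_zero (θ * I)
    field_simp
  rw [setIntegral_congr_fun (measurableSet_Ioi.prod measurableSet_Ioo) key, integral_const_mul,
    integral_add h₁i (h₂i.const_mul I), integral_const_mul, e₁, e₂]
  ring

/-- The Cauchy–Pompeiu formula for compactly supported functions. -/
theorem integral_dbar_div_sub {f : ℂ → ℂ} (hf : ContDiff ℝ 1 f) (hs : HasCompactSupport f)
    (z : ℂ) : ∫ w, dbar f w / (w - z) = -(Real.pi * f z) := by
  have h := integral_dbar_div (f := fun w => f (w + z)) (hf.comp (contDiff_id.add contDiff_const))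
    (hs.comp_homeomorph (Homeomorph.addRight z))
  rw [zero_add] at h
  rw [← h, ← integral_add_right_eq_self _ z]
  simp [dbar, fderiv_comp_add_right]

/-- The Cauchy transform of `g`. -/
noncomputable def cauchyTransform (g : ℂ → ℂ) (w : ℂ) : ℂ := (Real.pi : ℂ)⁻¹ * ∫ z, g z / (w - z)

/-- The singular part of the modulus of the Cauchy kernel. -/
noncomputable def cauchyKernelBound (u : ℂ) : ℝ := (Metric.ball (0 : ℂ) 1).indicator (fun u => ‖u‖⁻¹) u

theorem integrable_cauchyKernelBound : Integrable cauchyKernelBound := by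
  have : IntegrableOn (fun u : ℂ => ‖u‖⁻¹) (Metric.ball (0 : ℂ) 1) := by
    refine integrableOn_ball_of_norm_le_rpow (C := 1) (α := 1) ?_ ?_ ?_ ?_
    · rw [Complex.finrank_real_complex]; norm_num
    · rw [Complex.finrank_real_complex]; norm_num
    · refine Filter.Eventually.of_forall fun x => ?_
      rw [Real.rpow_neg_one]; simp
    · exact (measurable_norm.inv).aestronglyMeasurable
  exact this.integrable_indicator Metric.isOpen_ball.measurableSet

theorem norm_inv_le_one_add_cauchyKernelBound (u : ℂ) : ‖u‖⁻¹ ≤ 1 + cauchyKernelBound u := by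
  unfold cauchyKernelBound
  by_cases h : u ∈ Metric.ball (0 : ℂ) 1
  · rw [indicator_of_mem h]; linarith
  · rw [indicator_of_notMem h, add_zero]
    exact inv_le_one_of_one_le₀ (by simpa using h)

theorem cauchyKernelBound_nonneg (u : ℂ) : 0 ≤ cauchyKernelBound u :=
  indicator_nonneg (fun _ _ => by positivity) u

section
variable {g : ℂ → ℂ} {M : ℝ} {K : Set ℂ}

/-- The kernel is split into a part bounded by 1, which needs the support of g to be integrable, and
a singular part that is integrable on the whole plane. -/
theorem norm_div_sub_le (hM : 0 ≤ M) {z : ℂ} (hgM : ‖g z‖ ≤ M) (hgK : z ∉ K → g z = 0) (w : ℂ) :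
    ‖g z / (w - z)‖ ≤ M * (K.indicator 1 z + cauchyKernelBound (z - w)) := by
  by_cases hz : z ∈ K
  · rw [indicator_of_mem hz, norm_div, div_eq_mul_inv, norm_sub_rev]
    exact mul_le_mul hgM (norm_inv_le_one_add_cauchyKernelBound _) (by positivity) hM
  · rw [hgK hz]
    have : (0 : ℝ) ≤ K.indicator 1 z := indicator_nonneg (fun _ _ => zero_le_one) z
    have := cauchyKernelBound_nonneg (z - w)
    simp only [zero_div, norm_zero]; positivity

theorem measurable_cauchyTransform (hg : StronglyMeasurable g) :
    StronglyMeasurable (cauchyTransform g) := by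
  refine StronglyMeasurable.const_mul ?_ _
  refine StronglyMeasurable.integral_prod_right (f := fun w z => g z / (w - z)) ?_
  exact ((hg.measurable.comp measurable_snd).div (measurable_fst.sub measurable_snd)).stronglyMeasurable

theorem integrable_indicator_one_of_isCompact (hK : IsCompact K) :
    Integrable (K.indicator (1 : ℂ → ℝ)) :=
  (integrable_indicator_iff hK.measurableSet).2 (
    integrableOn_const (C := (1 : ℝ)) hK.measure_lt_top.ne)

theorem exists_norm_cauchyTransform_le (hM : 0 ≤ M) (hgM : ∀ᵐ z, ‖g z‖ ≤ M) (hK : IsCompact K)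
    (hgK : ∀ z ∉ K, g z = 0) : ∃ C, ∀ w, ‖cauchyTransform g w‖ ≤ C := by
  refine ⟨‖(Real.pi : ℂ)⁻¹‖ * (M * ((∫ z, K.indicator 1 z) + ∫ z, cauchyKernelBound z)), fun w => ?_⟩
  rw [cauchyTransform, norm_mul]
  refine mul_le_mul_of_nonneg_left ?_ (norm_nonneg _)
  have h1 := integrable_indicator_one_of_isCompact hK
  have h2 : Integrable fun z => cauchyKernelBound (z - w) := integrable_cauchyKernelBound.comp_sub_right w
  refine (norm_integral_le_of_norm_le ((h1.add h2).const_mul M)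
    (g := fun z => M * (K.indicator 1 z + cauchyKernelBound (z - w))) ?_).trans_eq ?_
  · filter_upwards [hgM] with z hz
    exact norm_div_sub_le hM hz (hgK z) w
  · rw [integral_const_mul, integral_add h1 h2, integral_sub_right_eq_self]

/-- The weak form of ∂̄(Tg) = g: exchange the integrals and apply Cauchy–Pompeiu to the inner one.
-/
theorem integral_cauchyTransform_mul_dbar (hg : StronglyMeasurable g) (hM : 0 ≤ M)
    (hgM : ∀ᵐ z, ‖g z‖ ≤ M) (hK : IsCompact K) (hgK : ∀ z ∉ K, g z = 0) {f : ℂ → ℂ}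
    (hf : ContDiff ℝ 1 f) (hs : HasCompactSupport f) :
    ∫ w, cauchyTransform g w * dbar f w = -∫ z, g z * f z := by
  have hdc : Continuous (dbar f) := continuous_dbar hf
  have hds : HasCompactSupport (dbar f) := hasCompactSupport_dbar hs
  have hdi : Integrable (dbar f) := hdc.integrable_of_hasCompactSupport hds
  have hint : Integrable (fun p : ℂ × ℂ => g p.1 / (p.2 - p.1) * dbar f p.2)
      (volume.prod volume) := by
    -- Fubini needs a dominating function: a product for the bounded part of the kernel, and a
    -- convolution integrand for the singular part.
    have b1 := (integrable_indicator_one_of_isCompact hK).mul_prod hdi.norm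
    have b2 := hdi.norm.convolution_integrand (ContinuousLinearMap.mul ℝ ℝ)
      integrable_cauchyKernelBound
    refine ((b1.add b2).const_mul M).mono' ?_ ?_
    · exact (((hg.measurable.comp measurable_fst).div (measurable_snd.sub measurable_fst)).mul
        (hdc.measurable.comp measurable_snd)).aestronglyMeasurable
    · have : ∀ᵐ p : ℂ × ℂ ∂(volume.prod volume), ‖g p.1‖ ≤ M :=
        Measure.quasiMeasurePreserving_fst.ae hgM
      filter_upwards [this] with p hp
      rw [norm_mul]
      refine (mul_le_mul_of_nonneg_right (norm_div_sub_le hM hp (hgK p.1) p.2)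
        (norm_nonneg _)).trans_eq ?_
      simp; ring
  have e1 : ∀ w, cauchyTransform g w * dbar f w =
      (Real.pi : ℂ)⁻¹ * ∫ z, g z / (w - z) * dbar f w := fun w => by
    rw [cauchyTransform, integral_mul_const, mul_assoc]
  have e2 : ∀ z, ∫ w, g z / (w - z) * dbar f w = -(Real.pi * (g z * f z)) := fun z => by
    rw [← mul_left_comm, ← mul_neg, ← integral_dbar_div_sub hf hs z, ← integral_const_mul]
    congr 1; ext w; ring
  simp_rw [e1]
  rw [integral_const_mul, ← integral_integral_swap (f := fun z w => g z / (w - z) * dbar f w) hint]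
  simp_rw [e2]
  rw [integral_neg, integral_const_mul, mul_neg, ← mul_assoc,
    inv_mul_cancel₀ (by exact_mod_cast Real.pi_ne_zero), one_mul]
end

/-! ### Extremals and the landslide set -/

section
variable {S : Set ℂ}

theorem Bel.norm_le_iff (μ : Bel S) {C : ℝ} (hC : 0 ≤ C) :
    ‖μ‖ ≤ C ↔ ∀ᵐ z ∂(volume : Measure ℂ).restrict S, ‖μ z‖ ≤ C := by
  rw [Lp.norm_def, eLpNorm_exponent_top, eLpNormEssSup]
  constructor
  · intro h
    have h' : essSup (fun z => ‖μ z‖ₑ) (volume.restrict S) ≤ ENNReal.ofReal C := by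
      refine (ENNReal.le_ofReal_iff_toReal_le ?_ hC).2 h
      exact (Lp.eLpNorm_lt_top μ).ne
    filter_upwards [ENNReal.ae_le_essSup (fun z => ‖μ z‖ₑ)] with z hz
    have := hz.trans h'
    rwa [← ofReal_norm, ENNReal.ofReal_le_ofReal_iff hC] at this
  · intro h
    refine ENNReal.toReal_le_of_le_ofReal hC (essSup_le_of_ae_le _ ?_)
    filter_upwards [h] with z hz
    rw [← ofReal_norm]
    exact ENNReal.ofReal_le_ofReal hz

theorem Bel.ae_norm_le (μ : Bel S) : ∀ᵐ z ∂(volume : Measure ℂ).restrict S, ‖μ z‖ ≤ ‖μ‖ :=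
  (μ.norm_le_iff (norm_nonneg _)).1 le_rfl

theorem isExtremalIn_of_norm_le {η : Bel S} {τ : InfTeich S}
    (h : (Submodule.Quotient.mk η : InfTeich S) = τ) (hn : ‖η‖ ≤ ‖τ‖) : IsExtremalIn η τ :=
  ⟨h, le_antisymm hn (h ▸ Submodule.Quotient.norm_mk_le (infTrivial S) η)⟩

/-- Averaging combines extremals that are small on different sets into one that is small on their
union. -/
theorem IsExtremalIn.midpoint {η₁ η₂ : Bel S} {τ : InfTeich S} (h₁ : IsExtremalIn η₁ τ)
    (h₂ : IsExtremalIn η₂ τ) : IsExtremalIn ((1 / 2 : ℂ) • (η₁ + η₂)) τ := by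
  refine isExtremalIn_of_norm_le ?_ ?_
  · rw [Submodule.Quotient.mk_smul, Submodule.Quotient.mk_add, h₁.1, h₂.1, ← two_smul ℂ τ,
      smul_smul]
    norm_num
  · rw [norm_smul]
    have := norm_add_le η₁ η₂
    rw [h₁.2, h₂.2] at this
    norm_num
    linarith

theorem localDil_lt_iff {μ : Bel S} {p : ℂ} {c : ℝ≥0∞} :
    localDil μ p < c ↔ ∃ U : Set ℂ, (IsOpen U ∧ p ∈ U ∧ U ⊆ S) ∧
      essSup (fun z => ‖μ z‖ₑ) ((volume : Measure ℂ).restrict U) < c := by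
  simp only [localDil, iInf_lt_iff, exists_prop]

theorem mem_landslideSet_iff {τ : InfTeich S} {p : ℂ} :
    p ∈ landslideSet τ ↔ ∃ η : Bel S, IsExtremalIn η τ ∧ ∃ U : Set ℂ,
      (IsOpen U ∧ p ∈ U ∧ U ⊆ S) ∧
        essSup (fun z => ‖η z‖ₑ) ((volume : Measure ℂ).restrict U) < ENNReal.ofReal ‖τ‖ := by
  simp only [landslideSet, mem_ofPred_eq, classLocalDil, iInf_lt_iff, localDil_lt_iff, exists_prop]
  exact ⟨fun h => h.2, fun h => ⟨let ⟨_, _, _, hU, _⟩ := h; hU.2.2 hU.2.1, h⟩⟩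

theorem landslideSet_subset (τ : InfTeich S) : landslideSet τ ⊆ S := fun _ h => h.1

theorem isOpen_landslideSet (τ : InfTeich S) : IsOpen (landslideSet τ) := by
  rw [isOpen_iff_forall_mem_open]
  intro p hp
  obtain ⟨η, hη, U, hU, hlt⟩ := mem_landslideSet_iff.1 hp
  exact ⟨U, fun q hq => mem_landslideSet_iff.2 ⟨η, hη, U, ⟨hU.1, hq, hU.2.2⟩, hlt⟩, hU.1, hU.2.1⟩

/-- On compact subsets of the landslide set, some extremal is uniformly smaller than the norm of
the class. -/
theorem exists_extremal_le_of_isCompact {τ : InfTeich S} (hne : (landslideSet τ).Nonempty)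
    {T : Set ℂ} (hT : IsCompact T) (hTL : T ⊆ landslideSet τ) :
    ∃ η : Bel S, IsExtremalIn η τ ∧ ∃ δ > 0,
      ∀ᵐ z ∂(volume : Measure ℂ).restrict T, ‖η z‖ ≤ ‖τ‖ - δ := by
  -- The induction over subsets of T passes through arbitrary sets; intersecting with the landslide
  -- set keeps them inside S, where the bounds by ‖τ‖ hold.
  suffices h : ∃ η : Bel S, IsExtremalIn η τ ∧ ∃ δ > 0,
      ∀ᵐ z ∂(volume : Measure ℂ).restrict (T ∩ landslideSet τ), ‖η z‖ ≤ ‖τ‖ - δ by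
    rwa [inter_eq_self_of_subset_left hTL] at h
  refine hT.induction_on (p := fun T => ∃ η : Bel S, IsExtremalIn η τ ∧ ∃ δ > 0,
      ∀ᵐ z ∂(volume : Measure ℂ).restrict (T ∩ landslideSet τ), ‖η z‖ ≤ ‖τ‖ - δ) ?_ ?_ ?_ ?_
  · obtain ⟨p, hp⟩ := hne
    obtain ⟨η, hη, -⟩ := mem_landslideSet_iff.1 hp
    exact ⟨η, hη, 1, one_pos, by simp⟩
  · rintro s t hst ⟨η, hη, δ, hδ, h⟩
    exact ⟨η, hη, δ, hδ, ae_restrict_of_ae_restrict_of_subset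
      (inter_subset_inter_left _ hst) h⟩
  · rintro s t ⟨η₁, h₁, δ₁, hδ₁, hb₁⟩ ⟨η₂, h₂, δ₂, hδ₂, hb₂⟩
    have hLS := landslideSet_subset τ
    have hSt : ∀ A : Set ℂ, A ⊆ S → (volume : Measure ℂ).restrict A ≤ volume.restrict S :=
      fun A hA => Measure.restrict_mono hA le_rfl
    -- On each piece one extremal gains its δ and the other is at most ‖τ‖, so the average gains
    -- half.
    refine ⟨_, h₁.midpoint h₂, min δ₁ δ₂ / 2, by positivity, ?_⟩
    have key : ∀ᵐ z ∂(volume : Measure ℂ).restrict S,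
        ‖((1 / 2 : ℂ) • (η₁ + η₂) : Bel S) z‖ ≤ (‖η₁ z‖ + ‖η₂ z‖) / 2 ∧
          ‖η₁ z‖ ≤ ‖τ‖ ∧ ‖η₂ z‖ ≤ ‖τ‖ := by
      filter_upwards [Lp.coeFn_smul (1 / 2 : ℂ) (η₁ + η₂), Lp.coeFn_add η₁ η₂, η₁.ae_norm_le,
        η₂.ae_norm_le] with z e₁ e₂ e₃ e₄
      refine ⟨?_, h₁.2 ▸ e₃, h₂.2 ▸ e₄⟩
      rw [e₁, Pi.smul_apply, e₂, Pi.add_apply, norm_smul]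
      have := norm_add_le (η₁ z) (η₂ z)
      norm_num
      linarith
    rw [union_inter_distrib_right, ae_restrict_union_iff]
    have m₁ := min_le_left δ₁ δ₂
    have m₂ := min_le_right δ₁ δ₂
    constructor
    · filter_upwards [ae_mono (hSt _ (inter_subset_right.trans hLS)) key, hb₁] with z hz hz'
      linarith [hz.1, hz.2.1, hz.2.2]
    · filter_upwards [ae_mono (hSt _ (inter_subset_right.trans hLS)) key, hb₂] with z hz hz'
      linarith [hz.1, hz.2.1, hz.2.2]
  · intro p hp
    obtain ⟨η, hη, U, hU, hlt⟩ := mem_landslideSet_iff.1 (hTL hp)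
    obtain ⟨c, hc₁, hc₂⟩ := exists_between hlt
    have hτ : 0 < ‖τ‖ := ENNReal.ofReal_pos.1 (bot_le.trans_lt hlt)
    have hc : c ≠ ∞ := (hc₂.trans ENNReal.ofReal_lt_top).ne
    refine ⟨U, mem_nhdsWithin_of_mem_nhds (hU.1.mem_nhds hU.2.1), η, hη, ‖τ‖ - c.toReal, ?_, ?_⟩
    · have := (ENNReal.lt_ofReal_iff_toReal_lt hc).1 hc₂
      linarith
    · refine ae_restrict_of_ae_restrict_of_subset (inter_subset_left (s := U)) ?_
      filter_upwards [ENNReal.ae_le_essSup (μ := volume.restrict U) (fun z => ‖η z‖ₑ)] with z hz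
      have := ENNReal.toReal_mono hc (hz.trans hc₁.le)
      rw [toReal_enorm] at this
      linarith
end

/-! ### Infinitesimally trivial variations built from cutoff functions -/

section
variable {S : Set ℂ} {χ : ℂ → ℝ}

/-- Multiplying a holomorphic function by a cutoff function supported in its domain gives a `C¹`
function on the whole plane. -/
theorem contDiff_cutoff_mul (hS : IsOpen S) (hχ : ContDiff ℝ 1 χ) (hχS : tsupport χ ⊆ S)
    {φ : ℂ → ℂ} (hφ : DifferentiableOn ℂ φ S) : ContDiff ℝ 1 fun z => (χ z : ℂ) * φ z := by
  rw [contDiff_iff_contDiffAt]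
  intro z
  by_cases hz : z ∈ S
  · have h1 : ContDiffAt ℝ 1 φ z :=
      ((hφ.contDiffOn hS).contDiffAt (hS.mem_nhds hz) : ContDiffAt ℂ 1 φ z).restrict_scalars ℝ
    exact (ofRealCLM.contDiff.contDiffAt.comp z hχ.contDiffAt).mul h1
  · have : (fun z => (χ z : ℂ) * φ z) =ᶠ[nhds z] fun _ => 0 := by
      filter_upwards [notMem_tsupport_iff_eventuallyEq.1 fun h => hz (hχS h)] with w hw
      simp [hw]
    exact contDiffAt_const.congr_of_eventuallyEq this

theorem dbar_eq_zero_of_eventuallyEq {f : ℂ → ℂ} {z c : ℂ} (h : f =ᶠ[nhds z] fun _ => c) :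
    dbar f z = 0 := by
  simp [dbar, h.fderiv_eq]

/-- The product rule with ∂̄φ = 0 on S; off S both sides vanish because χ does so locally. -/
theorem dbar_cutoff_mul (hS : IsOpen S) (hχ : ContDiff ℝ 1 χ) (hχS : tsupport χ ⊆ S)
    {φ : ℂ → ℂ} (hφ : DifferentiableOn ℂ φ S) (z : ℂ) :
    dbar (fun z => (χ z : ℂ) * φ z) z = dbar (fun z => (χ z : ℂ)) z * φ z := by
  by_cases hz : z ∈ S
  · have h1 : DifferentiableAt ℂ φ z := hφ.differentiableAt (hS.mem_nhds hz)
    have h2 : DifferentiableAt ℝ (fun z => (χ z : ℂ)) z :=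
      (ofRealCLM.contDiff.comp hχ).differentiable one_ne_zero z
    have h3 : fderiv ℝ φ z I = I * fderiv ℝ φ z 1 := by
      rw [h1.fderiv_restrictScalars ℝ]
      simp
    simp only [dbar]
    rw [fderiv_fun_mul h2 (h1.restrictScalars ℝ)]
    simp only [add_apply, smul_apply, smul_eq_mul, h3]
    linear_combination (χ z * fderiv ℝ φ z 1 / 2) * I_sq
  · have h := notMem_tsupport_iff_eventuallyEq.1 fun h => hz (hχS h)
    rw [dbar_eq_zero_of_eventuallyEq (c := 0), dbar_eq_zero_of_eventuallyEq (c := 0), zero_mul]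
    · filter_upwards [h] with w hw; simp [hw]
    · filter_upwards [h] with w hw; simp [hw]

/-- The Beltrami differential obtained from `η` by cutting off with `χ` and correcting by the
Cauchy transform. It is infinitesimally trivial. -/
noncomputable def cutoffVariation (χ : ℂ → ℝ) (η : ℂ → ℂ) (w : ℂ) : ℂ :=
  χ w * η w + cauchyTransform ((tsupport χ).indicator η) w * dbar (fun z => (χ z : ℂ)) w

theorem ae_norm_indicator_le (μ : Bel S) {K : Set ℂ} (hS : MeasurableSet S) (hK : K ⊆ S) :
    ∀ᵐ z, ‖K.indicator μ z‖ ≤ ‖μ‖ := by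
  have := μ.ae_norm_le
  rw [ae_restrict_iff' hS] at this
  filter_upwards [this] with z hz
  by_cases h : z ∈ K
  · rw [indicator_of_mem h]; exact hz (hK h)
  · rw [indicator_of_notMem h]; simp

theorem exists_norm_cauchyTransform_mul_dbar_le (hS : IsOpen S) (hχ : ContDiff ℝ 1 χ)
    (hχc : HasCompactSupport χ) (hχS : tsupport χ ⊆ S) (η : Bel S) :
    ∃ C > 0, ∀ w, ‖cauchyTransform ((tsupport χ).indicator η) w *
      dbar (fun z => (χ z : ℂ)) w‖ ≤ C := by
  obtain ⟨C₁, h₁⟩ := exists_norm_cauchyTransform_le (norm_nonneg η)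
    (ae_norm_indicator_le η hS.measurableSet hχS) hχc (fun z hz => indicator_of_notMem hz _)
  have hχ' := hasCompactSupport_ofReal_comp hχc
  obtain ⟨C₂, h₂⟩ := (hasCompactSupport_dbar hχ').exists_bound_of_continuous
    (continuous_dbar (ofRealCLM.contDiff.comp hχ))
  -- The added 1 makes the constant positive, so that it can serve as a divisor later.
  refine ⟨C₁ * C₂ + 1, ?_, fun w => ?_⟩
  · have := (norm_nonneg _).trans (h₁ 0)
    have := (norm_nonneg _).trans (h₂ 0)
    positivity
  · rw [norm_mul]
    have := mul_le_mul (h₁ w) (h₂ w) (norm_nonneg _) ((norm_nonneg _).trans (h₁ 0))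
    linarith

theorem stronglyMeasurable_correction (hχ : ContDiff ℝ 1 χ) (η : Bel S) :
    StronglyMeasurable fun w => cauchyTransform ((tsupport χ).indicator η) w *
      dbar (fun z => (χ z : ℂ)) w :=
  (measurable_cauchyTransform ((Lp.stronglyMeasurable η).indicator
    (isClosed_tsupport χ).measurableSet)).mul
    (continuous_dbar (ofRealCLM.contDiff.comp hχ)).stronglyMeasurable

/-- Since φ is holomorphic, φ∂̄χ = ∂̄(χφ). The pairing is therefore ∫ gf + ∫ Tg·∂̄f with f = χφ, and
the two terms cancel by the weak ∂̄ equation. -/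
theorem integral_cutoffVariation_mul (hS : IsOpen S) (hχ : ContDiff ℝ 1 χ)
    (hχc : HasCompactSupport χ) (hχS : tsupport χ ⊆ S) (η : Bel S) {φ : ℂ → ℂ}
    (hφ : IsQuadDiff S φ) : ∫ z in S, cutoffVariation χ η z * φ z = 0 := by
  set g := (tsupport χ).indicator (η : ℂ → ℂ)
  set f : ℂ → ℂ := fun z => (χ z : ℂ) * φ z
  have hfC : ContDiff ℝ 1 f := contDiff_cutoff_mul hS hχ hχS hφ.1
  have hχ' := hasCompactSupport_ofReal_comp hχc
  have hfs : HasCompactSupport f := hχ'.mul_right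
  have hg : StronglyMeasurable g :=
    (Lp.stronglyMeasurable η).indicator (isClosed_tsupport χ).measurableSet
  have main := integral_cauchyTransform_mul_dbar hg (norm_nonneg η)
    (ae_norm_indicator_le η hS.measurableSet hχS) hχc (fun z hz => indicator_of_notMem hz _)
    hfC hfs
  obtain ⟨C, -, hC⟩ := exists_norm_cauchyTransform_mul_dbar_le hS hχ hχc hχS η
  have e : ∀ z, cutoffVariation χ η z * φ z = g z * f z + cauchyTransform g z * dbar f z := by
    intro z
    rw [dbar_cutoff_mul hS hχ hχS hφ.1, cutoffVariation]
    by_cases hz : z ∈ tsupport χ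
    · simp only [g, f, indicator_of_mem hz]; ring
    · simp only [f, image_eq_zero_of_notMem_tsupport hz]; push_cast; ring
  have z1 : ∀ z ∉ S, g z * f z = 0 := fun z hz => by
    simp [f, image_eq_zero_of_notMem_tsupport fun h => hz (hχS h)]
  have z2 : ∀ z ∉ S, cauchyTransform g z * dbar f z = 0 := fun z hz => by
    rw [dbar_eq_zero_of_eventuallyEq (c := 0), mul_zero]
    filter_upwards [notMem_tsupport_iff_eventuallyEq.1 fun h => hz (hχS h)] with w hw
    simp [f, hw]
  have i1 : IntegrableOn (fun z => g z * f z) S := by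
    obtain ⟨B, hB⟩ := hχ'.exists_bound_of_continuous (continuous_ofReal.comp hχ.continuous)
    have : Integrable (fun z => (χ z : ℂ) * (η z * φ z)) (volume.restrict S) :=
      (η.integrable_mul hφ).bdd_mul (continuous_ofReal.comp hχ.continuous).aestronglyMeasurable
        (Filter.Eventually.of_forall hB)
    refine this.congr (Filter.Eventually.of_forall fun z => ?_)
    by_cases hz : z ∈ tsupport χ
    · simp only [g, f, indicator_of_mem hz]; ring
    · simp [f, image_eq_zero_of_notMem_tsupport hz]
  have i2 : IntegrableOn (fun z => cauchyTransform g z * dbar f z) S := by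
    have : Integrable (fun z => cauchyTransform g z * dbar (fun z => (χ z : ℂ)) z * φ z)
        (volume.restrict S) :=
      hφ.2.bdd_mul (stronglyMeasurable_correction hχ η).aestronglyMeasurable
        (Filter.Eventually.of_forall hC)
    refine this.congr (Filter.Eventually.of_forall fun z => ?_)
    simp only [f]
    rw [dbar_cutoff_mul hS hχ hχS hφ.1, mul_assoc]
  simp_rw [e]
  rw [integral_add i1 i2, setIntegral_eq_integral_of_forall_compl_eq_zero z1,
    setIntegral_eq_integral_of_forall_compl_eq_zero z2, main, add_neg_cancel]

theorem memLp_cutoffVariation (hS : IsOpen S) (hχ : ContDiff ℝ 1 χ)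
    (hχc : HasCompactSupport χ) (hχS : tsupport χ ⊆ S) (η : Bel S) :
    MemLp (cutoffVariation χ η) ∞ (volume.restrict S) := by
  obtain ⟨C, -, hC⟩ := exists_norm_cauchyTransform_mul_dbar_le hS hχ hχc hχS η
  refine MemLp.add ?_ ?_
  · obtain ⟨B, hB⟩ := hχc.exists_bound_of_continuous hχ.continuous
    refine memLp_top_of_bound ?_ (B * ‖η‖) ?_
    · exact ((continuous_ofReal.comp hχ.continuous).stronglyMeasurable.mul
        (Lp.stronglyMeasurable η)).aestronglyMeasurable
    · filter_upwards [η.ae_norm_le] with z hz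
      rw [norm_mul, norm_real]
      exact mul_le_mul (hB z) hz (norm_nonneg _) ((norm_nonneg _).trans (hB z))
  · exact memLp_top_of_bound (stronglyMeasurable_correction hχ η).aestronglyMeasurable C
      (Filter.Eventually.of_forall hC)

/-- If a cutoff function supported in `S` varies only on the landslide set, then it does not
equal `1` near a point outside the landslide set. -/
theorem mem_landslideSet_of_cutoff (hS : IsOpen S) {τ : InfTeich S}
    (hne : (landslideSet τ).Nonempty) (hχ : ContDiff ℝ 1 χ) (hχc : HasCompactSupport χ)
    (hχS : tsupport χ ⊆ S) (hχ0 : ∀ z, 0 ≤ χ z) (hχ1 : ∀ z, χ z ≤ 1)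
    (hT : tsupport (dbar fun z => (χ z : ℂ)) ⊆ landslideSet τ) {p : ℂ}
    (hp : ∀ᶠ z in nhds p, χ z = 1) : p ∈ landslideSet τ := by
  have hχ' := hasCompactSupport_ofReal_comp hχc
  obtain ⟨η, hη, δ, hδ, hηδ⟩ := exists_extremal_le_of_isCompact hne
    (hasCompactSupport_dbar hχ') hT
  have hτ : 0 < ‖τ‖ := by
    obtain ⟨q, hq⟩ := hne
    exact ENNReal.ofReal_pos.1 (bot_le.trans_lt hq.2)
  obtain ⟨C, hC0, hC⟩ := exists_norm_cauchyTransform_mul_dbar_le hS hχ hχc hχS η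
  -- The bound ε ≤ 1 keeps 1 - εχ nonnegative; the bound ε ≤ δ/C lets the margin δ absorb the
  -- correction where ∂̄χ may be nonzero.
  set ε := min 1 (δ / C)
  have hε0 : 0 < ε := by positivity
  have hε1 : ε ≤ 1 := min_le_left _ _
  have hεC : ε * C ≤ δ := (le_div_iff₀ hC0).1 (min_le_right _ _)
  set β : Bel S := (memLp_cutoffVariation hS hχ hχc hχS η).toLp _
  have hβ : β ∈ infTrivial S := by
    intro φ hφ
    rw [← integral_cutoffVariation_mul hS hχ hχc hχS η hφ]
    refine integral_congr_ae ?_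
    filter_upwards [(memLp_cutoffVariation hS hχ hχc hχS η).coeFn_toLp] with z hz
    rw [hz]
  set η' : Bel S := η - (ε : ℂ) • β
  have hval : ∀ᵐ z ∂(volume : Measure ℂ).restrict S, ‖η' z‖ ≤ (1 - ε * χ z) * ‖η z‖ +
      ε * ‖cauchyTransform ((tsupport χ).indicator η) z * dbar (fun z => (χ z : ℂ)) z‖ := by
    filter_upwards [(memLp_cutoffVariation hS hχ hχc hχS η).coeFn_toLp,
      Lp.coeFn_sub η ((ε : ℂ) • β), Lp.coeFn_smul (ε : ℂ) β] with z h1 h2 h3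
    rw [h2, Pi.sub_apply, h3, Pi.smul_apply, h1, cutoffVariation, smul_eq_mul]
    have h4 : 0 ≤ 1 - ε * χ z := by nlinarith [hχ0 z, hχ1 z]
    calc _ = ‖((1 - ε * χ z : ℝ) : ℂ) * η z - (ε : ℂ) *
          (cauchyTransform ((tsupport χ).indicator η) z * dbar (fun z => (χ z : ℂ)) z)‖ := by
            congr 1; push_cast; ring
      _ ≤ _ := (norm_sub_le _ _).trans_eq (by
            rw [norm_mul, norm_mul (ε : ℂ), norm_real, norm_real, Real.norm_of_nonneg h4,
              Real.norm_of_nonneg hε0.le])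
  have hT' : ∀ᵐ z ∂(volume : Measure ℂ).restrict S,
      z ∈ tsupport (dbar fun z => (χ z : ℂ)) → ‖η z‖ ≤ ‖τ‖ - δ := by
    rw [ae_restrict_iff' (isClosed_tsupport _).measurableSet] at hηδ
    exact ae_restrict_of_ae hηδ
  have hη' : IsExtremalIn η' τ := by
    refine isExtremalIn_of_norm_le ?_ ?_
    · rw [← hη.1, Submodule.Quotient.eq]
      simpa [η'] using (infTrivial S).smul_mem (ε : ℂ) hβ
    · rw [Bel.norm_le_iff _ hτ.le]
      filter_upwards [hval, hT', η.ae_norm_le] with z h1 h2 h3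
      rw [hη.2] at h3
      have hx : (1 - ε * χ z) * ‖η z‖ ≤ ‖η z‖ := by
        have := mul_nonneg (mul_nonneg hε0.le (hχ0 z)) (norm_nonneg (η z))
        linarith
      by_cases hz : z ∈ tsupport (dbar fun z => (χ z : ℂ))
      · have := mul_le_mul_of_nonneg_left (hC z) hε0.le
        linarith [h2 hz]
      · rw [image_eq_zero_of_notMem_tsupport hz, mul_zero, norm_zero, mul_zero] at h1
        linarith
  obtain ⟨U, hU1, hUo, hpU⟩ := eventually_nhds_iff.1 hp
  have hUS : U ⊆ S := fun z hz => hχS (subset_tsupport _ (by simp [hU1 z hz]))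
  refine mem_landslideSet_iff.2 ⟨η', hη', U, ⟨hUo, hpU, hUS⟩, ?_⟩
  have hlt : ENNReal.ofReal ((1 - ε) * ‖τ‖) < ENNReal.ofReal ‖τ‖ := by
    refine (ENNReal.ofReal_lt_ofReal_iff hτ).2 ?_
    nlinarith
  refine (essSup_le_of_ae_le _ ?_).trans_lt hlt
  filter_upwards [ae_restrict_of_ae_restrict_of_subset hUS hval,
    ae_restrict_of_ae_restrict_of_subset hUS η.ae_norm_le,
    ae_restrict_mem hUo.measurableSet] with z h1 h2 hz
  rw [← ofReal_norm]
  refine ENNReal.ofReal_le_ofReal ?_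
  have h0 : dbar (fun z => (χ z : ℂ)) z = 0 := by
    refine dbar_eq_zero_of_eventuallyEq (c := 1) ?_
    filter_upwards [hUo.mem_nhds hz] with w hw
    simp [hU1 w hw]
  rw [h0, mul_zero, norm_zero, mul_zero, hU1 z hz, mul_one, add_zero] at h1
  rw [hη.2] at h2
  exact h1.trans (mul_le_mul_of_nonneg_left h2 (by linarith))
end

/-! ### Separating a bounded component, and the absence of holes -/

theorem IsClosed.connectedComponentIn_isClosed {X : Type*} [TopologicalSpace X] {E : Set X}
    (hE : IsClosed E) (x : X) : IsClosed (connectedComponentIn E x) := by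
  by_cases hx : x ∈ E
  · refine isClosed_of_closure_subset ?_
    refine isPreconnected_connectedComponentIn.closure.subset_connectedComponentIn
      (subset_closure (mem_connectedComponentIn hx)) ?_
    exact closure_minimal (connectedComponentIn_subset E x) hE
  · rw [connectedComponentIn_eq_empty hx]; exact isClosed_empty

/-- In a compact Hausdorff space, every neighbourhood of a connected component contains a clopen
neighbourhood of it. -/
theorem exists_isClopen_subset_of_connectedComponent_subset {X : Type*} [TopologicalSpace X]
    [T2Space X] [CompactSpace X] {x : X} {U : Set X} (hU : IsOpen U)
    (hx : connectedComponent x ⊆ U) : ∃ s, IsClopen s ∧ x ∈ s ∧ s ⊆ U := by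
  rw [connectedComponent_eq_iInter_isClopen] at hx
  let N := {s : Set X // IsClopen s ∧ x ∈ s}
  have : Nonempty N := ⟨⟨univ, isClopen_univ, mem_univ x⟩⟩
  have hdir : Directed GE.ge fun s : N => s.val := by
    rintro ⟨s, hs, hxs⟩ ⟨t, ht, hxt⟩
    exact ⟨⟨s ∩ t, hs.inter ht, ⟨hxs, hxt⟩⟩, inter_subset_left, inter_subset_right⟩
  obtain ⟨s, hs⟩ := exists_subset_nhds_of_compactSpace hdir (fun s : N => s.2.1.1)
    fun y hy => hU.mem_nhds (hx hy)
  exact ⟨s, s.2.1, s.2.2, hs⟩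

/-- A compact component of a closed set can be separated from the rest of the set by a cutoff
function. -/
theorem exists_cutoff_of_component {E S : Set ℂ} (hE : IsClosed E) (hS : IsOpen S) {p : ℂ}
    (hp : p ∈ E) (hb : Bornology.IsBounded (connectedComponentIn E p))
    (hES : connectedComponentIn E p ⊆ S) :
    ∃ χ : ℂ → ℝ, ContDiff ℝ 1 χ ∧ HasCompactSupport χ ∧ tsupport χ ⊆ S ∧ (∀ z, 0 ≤ χ z) ∧
      (∀ z, χ z ≤ 1) ∧ (∀ᶠ z in nhds p, χ z = 1) ∧
      Disjoint (tsupport (dbar fun z => (χ z : ℂ))) E := by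
  have hH : IsCompact (connectedComponentIn E p) :=
    Metric.isCompact_of_isClosed_isBounded (hE.connectedComponentIn_isClosed p) hb
  obtain ⟨t, ht, hHt, htS⟩ := exists_compact_between hH hS hES
  set Y := E ∩ t
  have hY : IsCompact Y := ht.inter_left hE
  have hpt : p ∈ interior t := hHt (mem_connectedComponentIn hp)
  have hpY : p ∈ Y := ⟨hp, interior_subset hpt⟩
  have : CompactSpace Y := isCompact_iff_compactSpace.1 hY
  -- The component of p in `Y` lies in its component in `E`, hence in the interior of t; so some
  -- clopen piece of `Y` around p also stays there.
  obtain ⟨Z, hZ, hpZ, hZt⟩ := exists_isClopen_subset_of_connectedComponent_subset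
    (x := (⟨p, hpY⟩ : Y)) (isOpen_interior.preimage continuous_subtype_val (t := interior t)) (by
      intro y hy
      have : (y : ℂ) ∈ connectedComponentIn Y p := by
        rw [connectedComponentIn_eq_image hpY]; exact mem_image_of_mem _ hy
      exact hHt (connectedComponentIn_mono p inter_subset_left this))
  set K : Set ℂ := Subtype.val '' Z
  set L : Set ℂ := Subtype.val '' Zᶜ
  have hK : IsCompact K := hZ.1.isCompact.image continuous_subtype_val
  have hL : IsCompact L := hZ.compl.1.isCompact.image continuous_subtype_val
  have hKL : K ⊆ interior t \ L := by
    rintro _ ⟨y, hy, rfl⟩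
    refine ⟨hZt hy, ?_⟩
    rintro ⟨y', hy', h⟩
    exact hy' (Subtype.ext h ▸ hy)
  -- Inside t' the set E consists of points of `K` only, and χ will be 1 near `K` and 0 off t'. Thus
  -- χ is locally constant at every point of E.
  obtain ⟨t', ht', hKt', ht'S⟩ := exists_compact_between hK (isOpen_interior.sdiff hL.isClosed) hKL
  obtain ⟨f, hf1, hf0, hf⟩ := exists_contMDiffMap_one_nhds_of_subset_interior (n := 1)
    (modelWithCornersSelf ℝ ℂ) hK.isClosed hKt'
  have hfs : tsupport f ⊆ t' := closure_minimal (fun z hz => by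
    by_contra h; exact hz (hf0 z h)) ht'.isClosed
  refine ⟨f, f.contMDiff.contDiff, ht'.of_isClosed_subset (isClosed_tsupport _) hfs,
    hfs.trans (ht'S.trans (sdiff_subset.trans (interior_subset.trans htS))),
    fun z => (hf z).1, fun z => (hf z).2, ?_, ?_⟩
  · exact hf1.filter_mono (nhds_le_nhdsSet (show p ∈ K from ⟨⟨p, hpY⟩, hpZ, rfl⟩))
  · rw [Set.disjoint_left]
    intro z hz hzE
    by_cases hzt : z ∈ tsupport f
    · have h1 := ht'S (hfs hzt)
      have hzY : z ∈ Y := ⟨hzE, interior_subset h1.1⟩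
      have hzK : z ∈ K := by
        by_contra h
        refine h1.2 ⟨⟨z, hzY⟩, fun h' => h ⟨_, h', rfl⟩, rfl⟩
      have h2 : ∀ᶠ w in nhds z, ∀ᶠ v in nhds w, f v = 1 :=
        (hf1.filter_mono (nhds_le_nhdsSet hzK)).eventually_nhds
      refine notMem_tsupport_iff_eventuallyEq.2 ?_ hz
      filter_upwards [h2] with w hw
      exact dbar_eq_zero_of_eventuallyEq (c := 1) (hw.mono fun v hv => by simp [hv])
    · have h2 := (notMem_tsupport_iff_eventuallyEq.1 hzt).eventually_nhds
      refine notMem_tsupport_iff_eventuallyEq.2 ?_ hz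
      filter_upwards [h2] with w hw
      exact dbar_eq_zero_of_eventuallyEq (c := 0) (hw.mono fun v hv => by simp [hv])

/-- A bounded component of the complement of a plane set meets the closure of the set. -/
theorem exists_mem_component_compl_inter_closure {D : Set ℂ} (hD : IsOpen D) {p : ℂ} (hp : p ∈ Dᶜ)
    (hb : Bornology.IsBounded (connectedComponentIn Dᶜ p)) :
    (connectedComponentIn Dᶜ p ∩ closure D).Nonempty := by
  by_contra hne
  have hdis : connectedComponentIn Dᶜ p ⊆ (closure D)ᶜ := fun x hx hx' => hne ⟨x, hx, hx'⟩
  -- A component avoiding the closure of D absorbs small balls around its points; being clopen it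
  -- would be the whole plane, which is unbounded.
  have hopen : IsOpen (connectedComponentIn Dᶜ p) := by
    rw [isOpen_iff_mem_nhds]
    intro x hx
    obtain ⟨r, hr, hball⟩ := Metric.isOpen_iff.1 isClosed_closure.isOpen_compl x (hdis hx)
    refine Filter.mem_of_superset (Metric.ball_mem_nhds x hr) ?_
    rw [connectedComponentIn_eq hx]
    exact (convex_ball x r).isPreconnected.subset_connectedComponentIn (Metric.mem_ball_self hr)
      (hball.trans (compl_subset_compl.2 subset_closure))
  have huniv := IsClopen.eq_univ ⟨hD.isClosed_compl.connectedComponentIn_isClosed p, hopen⟩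
    ⟨p, mem_connectedComponentIn hp⟩
  rw [huniv] at hb
  exact NormedSpace.unbounded_univ ℝ ℂ hb

theorem not_hole_subset_of_component_landslideSet {S : Set ℂ} (hS : IsOpen S) {τ : InfTeich S}
    {D H : Set ℂ} (hD : IsComponentOf D (landslideSet τ)) (hH : IsHole H D) : ¬ H ⊆ S := by
  intro hHS
  obtain ⟨p₀, hp₀, rfl⟩ := hD
  set D := connectedComponentIn (landslideSet τ) p₀
  have hDo : IsOpen D := (isOpen_landslideSet τ).connectedComponentIn
  have hDL : D ⊆ landslideSet τ := connectedComponentIn_subset _ _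
  obtain ⟨⟨q, hq, rfl⟩, hb⟩ := hH
  obtain ⟨x, hxH, hxD⟩ := exists_mem_component_compl_inter_closure hDo hq hb
  have hHL : connectedComponentIn Dᶜ q ⊆ landslideSet τ := by
    intro y hy
    have hyD : y ∈ Dᶜ := connectedComponentIn_subset _ _ hy
    rw [connectedComponentIn_eq hy] at hHS hb
    obtain ⟨χ, h1, h2, h3, h4, h5, h6, h7⟩ :=
      exists_cutoff_of_component hDo.isClosed_compl hS hyD hb hHS
    refine mem_landslideSet_of_cutoff hS ⟨p₀, hp₀⟩ h1 h2 h3 h4 h5 ?_ h6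
    exact (disjoint_compl_right_iff_subset.1 h7).trans hDL
  -- Adjoining a closure point keeps `D` connected, so maximality of `D` puts x in `D`, although x
  -- lies in the hole.
  have hconn : IsPreconnected (insert x D) :=
    isPreconnected_connectedComponentIn.subset_closure (subset_insert x D)
      (insert_subset hxD subset_closure)
  have hsub : insert x D ⊆ D := hconn.subset_connectedComponentIn
    (mem_insert_of_mem _ (mem_connectedComponentIn hp₀)) (insert_subset (hHL hxH) hDL)
  exact connectedComponentIn_subset _ _ hxH (hsub (mem_insert x D))

/-! ### Winding numbers of polygonal paths -/

/-- A nonpositive real ratio would place q between a and z. Hence the principal logarithm is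
continuous along the segment. -/
theorem div_sub_mem_slitPlane {a b q z : ℂ} (hq : q ∉ segment ℝ a b) (hz : z ∈ segment ℝ a b) :
    (z - q) / (a - q) ∈ slitPlane := by
  have haq : a - q ≠ 0 := sub_ne_zero.2 fun h => hq (h ▸ left_mem_segment ℝ a b)
  by_contra hw
  set w := (z - q) / (a - q)
  rw [mem_slitPlane_iff, not_or, not_lt, not_not] at hw
  have hwr : w = ((w.re : ℝ) : ℂ) := Complex.ext (by simp) (by simp [hw.2])
  have hzq : z - q = w * (a - q) := by simp [w, haq]
  refine hq ((convex_segment a b).segment_subset (left_mem_segment ℝ a b) hz ?_)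
  have h1 : 0 < 1 - w.re := by linarith [hw.1]
  have h1' : (1 - (w.re : ℂ)) ≠ 0 := by exact_mod_cast h1.ne'
  -- These weights come from solving z - q = w(a - q) for q.
  refine ⟨-w.re / (1 - w.re), 1 / (1 - w.re), by have := hw.1; apply div_nonneg <;> linarith,
    by positivity, by field_simp; ring, ?_⟩
  simp only [real_smul]
  push_cast
  rw [hwr] at hzq
  field_simp
  linear_combination hzq

/-- The values lie in the discrete set 2πiℤ, where a continuous function on a connected set is
constant. -/
theorem IsPreconnected.eq_of_exp_eq_one {X : Type*} [TopologicalSpace X] {C : Set X}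
    (hC : IsPreconnected C) {h : X → ℂ} (hc : ContinuousOn h C) (h1 : ∀ x ∈ C, exp (h x) = 1)
    {x y : X} (hx : x ∈ C) (hy : y ∈ C) : h x = h y := by
  have hd : IsDiscrete (range ((↑) : ℤ → ℝ)) :=
    Int.isClosedEmbedding_coe_real.isEmbedding.isDiscrete_range
  have hval : ∀ x ∈ C, ∃ n : ℤ, h x = n * (2 * Real.pi * I) := fun x hx => exp_eq_one_iff.1 (h1 x hx)
  have hpi : (2 * Real.pi : ℝ) ≠ 0 := by positivity
  have key := hC.constant_of_mapsTo hd
    (f := fun x => (h x).im / (2 * Real.pi)) ((continuous_im.comp_continuousOn hc).div_const _)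
    (fun x hx => by
      obtain ⟨n, hn⟩ := hval x hx
      refine ⟨n, ?_⟩
      simp [hn, mul_comm (n : ℝ)]) hx hy
  obtain ⟨n, hn⟩ := hval x hx
  obtain ⟨m, hm⟩ := hval y hy
  have hnm : n = m := by simpa [hn, hm] using key
  rw [hn, hm, hnm]

/-- The increment along a segment of a branch of the logarithm of `z - q`. -/
theorem log_div_eq_sub_of_branch {a b q c : ℂ} {g : ℂ → ℂ} (hg : ContinuousOn g (segment ℝ a b))
    (hc : c ≠ 0) (hge : ∀ z ∈ segment ℝ a b, exp (g z) = c * (z - q)) :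
    log ((b - q) / (a - q)) = g b - g a := by
  have hq : q ∉ segment ℝ a b := fun h => exp_ne_zero _ ((hge q h).trans (by simp))
  have ha := left_mem_segment ℝ a b
  have haq : a - q ≠ 0 := sub_ne_zero.2 fun h => hq (h ▸ ha)
  have := (convex_segment (𝕜 := ℝ) a b).isPreconnected.eq_of_exp_eq_one
    (h := fun z => log ((z - q) / (a - q)) - (g z - g a))
    ((ContinuousOn.clog (by fun_prop) fun z hz => div_sub_mem_slitPlane hq hz).sub
      (hg.sub continuousOn_const)) (fun z hz => by
        have hzq : z - q ≠ 0 := sub_ne_zero.2 fun h => hq (h ▸ hz)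
        rw [exp_sub, exp_sub, exp_log (div_ne_zero hzq haq), hge z hz, hge a ha]
        field_simp) (right_mem_segment ℝ a b) ha
  simp only [div_self haq, log_one, sub_self] at this
  exact sub_eq_zero.1 this

/-- The change of `log (z - q)` along the polygonal path with the given vertices. -/
noncomputable def logSum (q : ℂ) : List ℂ → ℂ
  | a :: b :: t => log ((b - q) / (a - q)) + logSum q (b :: t)
  | _ => 0

theorem logSum_append (q a : ℂ) (l₁ l₂ : List ℂ) :
    logSum q (l₁ ++ a :: l₂) = logSum q (l₁ ++ [a]) + logSum q (a :: l₂) := by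
  induction l₁ with
  | nil => simp [logSum]
  | cons x t ih => cases t <;> simp_all [logSum, add_assoc]

/-- The quotients telescope. For a closed path the exponential is 1, so the sum is an integer
multiple of 2πi. -/
theorem exp_logSum {q a b : ℂ} {l : List ℂ} (hq : ∀ x ∈ a :: (l ++ [b]), x ≠ q) :
    exp (logSum q (a :: (l ++ [b]))) = (b - q) / (a - q) := by
  induction l generalizing a with
  | nil =>
    have h1 := sub_ne_zero.2 (hq a (by simp))
    have h2 := sub_ne_zero.2 (hq b (by simp))
    simp [logSum, exp_log (div_ne_zero h2 h1)]
  | cons x t ih =>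
    have h1 := sub_ne_zero.2 (hq a (by simp))
    have h2 := sub_ne_zero.2 (hq x (by simp))
    rw [List.cons_append, logSum, exp_add, ih fun y hy => hq y (List.mem_cons_of_mem _ hy),
      exp_log (div_ne_zero h2 h1)]
    field_simp

theorem logSum_eq_sub_of_branch {q c : ℂ} {g : ℂ → ℂ} {W : Set ℂ} (hg : ContinuousOn g W)
    (hc : c ≠ 0) (hge : ∀ z ∈ W, exp (g z) = c * (z - q)) {a b : ℂ} {l : List ℂ}
    (hl : List.IsChain (fun x y => segment ℝ x y ⊆ W) (a :: (l ++ [b]))) :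
    logSum q (a :: (l ++ [b])) = g b - g a := by
  induction l generalizing a with
  | nil =>
    simp at hl
    simp [logSum, log_div_eq_sub_of_branch (hg.mono hl) hc fun z hz => hge z (hl hz)]
  | cons x t ih =>
    rw [List.cons_append, List.isChain_cons_cons] at hl
    rw [List.cons_append, logSum, ih hl.2,
      log_div_eq_sub_of_branch (hg.mono hl.1) hc fun z hz => hge z (hl.1 hz)]
    ring

theorem mem_of_isChain_segment_subset {W : Set ℂ} {a b : ℂ} {l : List ℂ}
    (hl : List.IsChain (fun x y => segment ℝ x y ⊆ W) (a :: (l ++ [b]))) {x : ℂ}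
    (hx : x ∈ a :: (l ++ [b])) : x ∈ W := by
  induction l generalizing a with
  | nil =>
    simp at hl hx
    rcases hx with rfl | rfl
    · exact hl (left_mem_segment ℝ _ _)
    · exact hl (right_mem_segment ℝ _ _)
  | cons y t ih =>
    rw [List.cons_append, List.isChain_cons_cons] at hl
    rcases List.mem_cons.1 hx with rfl | hx
    · exact hl.1 (left_mem_segment ℝ _ _)
    · exact ih hl.2 hx

theorem continuousOn_logSum {W : Set ℂ} {l : List ℂ}
    (hl : List.IsChain (fun x y => segment ℝ x y ⊆ W) l) :
    ContinuousOn (fun q => logSum q l) Wᶜ := by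
  induction l with
  | nil => simpa [logSum] using continuousOn_const
  | cons a t ih =>
    cases t with
    | nil => simpa [logSum] using continuousOn_const
    | cons b t =>
      rw [List.isChain_cons_cons] at hl
      simp only [logSum]
      refine ContinuousOn.add (ContinuousOn.clog ?_ ?_) (ih hl.2)
      · refine ContinuousOn.div (by fun_prop) (by fun_prop) fun q hq => sub_ne_zero.2 ?_
        rintro rfl
        exact hq (hl.1 (left_mem_segment ℝ _ _))
      · exact fun q hq => div_sub_mem_slitPlane (fun h => hq (hl.1 h)) (right_mem_segment ℝ _ _)

/-- Every component of the complement of `D` is unbounded or not contained in `S`. -/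
def HolesLeave (D S : Set ℂ) : Prop :=
  ∀ q ∉ D, ¬ Bornology.IsBounded (connectedComponentIn Dᶜ q) ∨ ¬ connectedComponentIn Dᶜ q ⊆ S

/-- Seen from q outside the disc, log(1 - z/q) is a single-valued branch on the disc containing the
path. -/
theorem logSum_eq_zero_of_norm_lt {R : ℝ} {q a : ℂ} {l : List ℂ} (hq : R ≤ ‖q‖)
    (hl : ∀ x ∈ a :: (l ++ [a]), ‖x‖ < R) : logSum q (a :: (l ++ [a])) = 0 := by
  have hR : 0 < R := (norm_nonneg _).trans_lt (hl a (by simp))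
  have hq0 : q ≠ 0 := norm_pos_iff.1 (hR.trans_le hq)
  have hsl : ∀ z ∈ Metric.ball (0 : ℂ) R, 1 - z / q ∈ slitPlane := by
    intro z hz
    rw [mem_ball_zero_iff] at hz
    left
    have : ‖z / q‖ < 1 := by
      rw [norm_div, div_lt_one (hR.trans_le hq)]; exact hz.trans_le hq
    have := (re_le_norm (z / q)).trans_lt this
    simp; linarith
  rw [logSum_eq_sub_of_branch (W := Metric.ball 0 R) (c := -q⁻¹) (g := fun z => log (1 - z / q)),
    sub_self]
  · exact ContinuousOn.clog (by fun_prop) hsl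
  · simpa using hq0
  · intro z hz
    rw [exp_log (slitPlane_ne_zero (hsl z hz))]
    field_simp
    ring
  · refine List.Pairwise.isChain (List.pairwise_of_forall_mem_list fun x hx y hy => ?_)
    exact (convex_ball 0 R).segment_subset (mem_ball_zero_iff.2 (hl x hx))
      (mem_ball_zero_iff.2 (hl y hy))

/-- A closed polygonal path in `D` has winding number zero around the points outside `D`. -/
theorem logSum_eq_zero {D S : Set ℂ} (hSo : IsOpen S) (hS : IsSimplyConnected S) (hDS : D ⊆ S)
    (hDS' : HolesLeave D S) {a q : ℂ} {l : List ℂ}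
    (hl : List.IsChain (fun x y => segment ℝ x y ⊆ D) (a :: (l ++ [a]))) (hq : q ∉ D) :
    logSum q (a :: (l ++ [a])) = 0 := by
  have hmem : ∀ x ∈ a :: (l ++ [a]), x ∈ D := by
    exact fun x hx => mem_of_isChain_segment_subset hl hx
  set C := connectedComponentIn Dᶜ q
  have hCD : C ⊆ Dᶜ := connectedComponentIn_subset _ _
  -- The winding number is constant on the component of q, so it may be computed at a more
  -- convenient point s.
  have hconst : ∀ s ∈ C, logSum q (a :: (l ++ [a])) = logSum s (a :: (l ++ [a])) := by
    intro s hs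
    refine isPreconnected_connectedComponentIn.eq_of_exp_eq_one
      (h := fun q => logSum q (a :: (l ++ [a]))) ((continuousOn_logSum hl).mono hCD) ?_
      (mem_connectedComponentIn hq) hs
    intro x hx
    have hne : ∀ y ∈ a :: (l ++ [a]), y ≠ x := fun y hy h => hCD hx (h ▸ hmem y hy)
    rw [exp_logSum hne, div_self (sub_ne_zero.2 (hne a (by simp)))]
  rcases hDS' q hq with h | h
  · obtain ⟨R, hR⟩ : ∃ R, ∀ x ∈ a :: (l ++ [a]), ‖x‖ < R := by
      obtain ⟨R, hR⟩ := ((a :: (l ++ [a])).toFinset.finite_toSet.image norm).bddAbove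
      exact ⟨R + 1, fun x hx => (hR (mem_image_of_mem _
        (Finset.mem_coe.2 (List.mem_toFinset.2 hx)))).trans_lt (lt_add_one R)⟩
    obtain ⟨s, hs, hsR⟩ : ∃ s ∈ C, R ≤ ‖s‖ := by
      by_contra! hcon
      exact h (isBounded_iff_forall_norm_le.2 ⟨R, fun x hx => (hcon x hx).le⟩)
    rw [hconst s hs, logSum_eq_zero_of_norm_lt hsR hR]
  · obtain ⟨s, hs, hsS⟩ := not_subset.1 h
    obtain ⟨g, hgc, hg⟩ := exists_continuousOn_eqOn_exp_comp hS hSo (g := fun z => z - s)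
      (by fun_prop) (by
        rintro ⟨z, hz, h0⟩
        exact hsS (sub_eq_zero.1 h0 ▸ hz))
    rw [hconst s hs, logSum_eq_sub_of_branch hgc one_ne_zero (fun z hz => by simpa using hg hz)
      (hl.imp fun x y hxy => hxy.trans hDS), sub_self]

theorem log_im_pos {z : ℂ} (h : 0 < z.im) : 0 < (log z).im := by
  rw [log_im]
  refine lt_of_le_of_ne (arg_nonneg_iff.2 h.le) fun h0 => ?_
  exact h.ne' (arg_eq_zero_iff.1 h0.symm).2

theorem log_im_neg {z : ℂ} (h : z.im < 0) : (log z).im < 0 := by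
  rw [log_im]; exact arg_neg_iff.2 h

theorem div_im_eq_det (x y : ℂ) : (x / y).im = (x.im * y.re - x.re * y.im) / normSq y := by
  rw [div_im]; ring

theorem log_div_im_pos {x y : ℂ} (h : 0 < x.im * y.re - x.re * y.im) : 0 < (log (x / y)).im := by
  refine log_im_pos ?_
  rw [div_im_eq_det]
  refine div_pos h (normSq_pos.2 ?_)
  rintro rfl
  simp at h

theorem log_div_im_neg {x y : ℂ} (h : x.im * y.re - x.re * y.im < 0) : (log (x / y)).im < 0 := by
  refine log_im_neg ?_
  rw [div_im_eq_det]
  refine div_neg_of_neg_of_pos h (normSq_pos.2 ?_)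
  rintro rfl
  simp at h

/-! ### Lattice paths and the square at an extreme vertex -/

/-- The point of the square lattice of mesh `ε` with the given integer coordinates. -/
noncomputable def latticePt (ε : ℝ) (p : ℤ × ℤ) : ℂ := ⟨ε * p.1, ε * p.2⟩

/-- Two lattice points are equal or adjacent, and the lattice edge between them lies in `D`. -/
def LatticeStep (ε : ℝ) (D : Set ℂ) (p p' : ℤ × ℤ) : Prop :=
  |p.1 - p'.1| + |p.2 - p'.2| ≤ 1 ∧ segment ℝ (latticePt ε p) (latticePt ε p') ⊆ D

/-- The closed lattice square with upper right corner `v`. -/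
def latticeSquare (ε : ℝ) (v : ℤ × ℤ) : Set ℂ :=
  {z | ε * (v.1 - 1) ≤ z.re ∧ z.re ≤ ε * v.1 ∧ ε * (v.2 - 1) ≤ z.im ∧ z.im ≤ ε * v.2}

/-- Lexicographic comparison of lattice points. -/
def LexBelow (v p : ℤ × ℤ) : Prop := p.1 < v.1 ∨ (p.1 = v.1 ∧ p.2 < v.2)

/-- An edge below v in the lexicographic order lies wholly to the left of the square at v or wholly
beneath its upper edge level, so it cannot cross the diagonal ray leaving that square. -/
theorem LatticeStep.corner {ε : ℝ} {D : Set ℂ} {p p' v : ℤ × ℤ} (h : LatticeStep ε D p p')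
    (hp : LexBelow v p) (hp' : LexBelow v p') :
    (p.1 ≤ v.1 - 1 ∧ p'.1 ≤ v.1 - 1) ∨ (p.2 ≤ v.2 - 1 ∧ p'.2 ≤ v.2 - 1) := by
  have := h.1
  unfold LexBelow at hp hp'
  rw [abs_eq_max_neg, abs_eq_max_neg] at this
  omega

theorem re_le_of_mem_segment {a b z : ℂ} {c : ℝ} (hz : z ∈ segment ℝ a b) (ha : a.re ≤ c)
    (hb : b.re ≤ c) : z.re ≤ c :=
  (convex_halfSpace_re_le c).segment_subset ha hb hz

theorem im_le_of_mem_segment {a b z : ℂ} {c : ℝ} (hz : z ∈ segment ℝ a b) (ha : a.im ≤ c)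
    (hb : b.im ≤ c) : z.im ≤ c :=
  (convex_halfSpace_im_le c).segment_subset ha hb hz

section
variable {ε : ℝ} {D S : Set ℂ} {v a b : ℤ × ℤ} {m : List (ℤ × ℤ)} {q : ℂ}

/-- Slit along the diagonal ray from `q` towards the upper right. -/
theorem LatticeStep.segment_subset_slit (hε : 0 < ε) {p p' : ℤ × ℤ} (h : LatticeStep ε D p p')
    (hp : LexBelow v p) (hp' : LexBelow v p') (hq : q ∈ latticeSquare ε v) (hqD : q ∉ D) :
    segment ℝ (latticePt ε p) (latticePt ε p') ⊆ {z | -((z - q) * (1 - I)) ∈ slitPlane} := by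
  intro z hz
  by_contra hsl
  rw [mem_ofPred_eq, mem_slitPlane_iff, not_or, not_lt, not_not] at hsl
  simp at hsl
  have hne : z ≠ q := fun h' => hqD (h' ▸ h.2 hz)
  have hxy : z.im - q.im = z.re - q.re := by linarith [hsl.2]
  have hpos : 0 < z.re - q.re := by
    refine lt_of_le_of_ne (by linarith [hsl.1]) fun h0 => hne (Complex.ext ?_ ?_) <;> linarith
  obtain ⟨h1, -, h2, -⟩ := hq
  rcases h.corner hp hp' with ⟨c1, c2⟩ | ⟨c1, c2⟩
  · have : z.re ≤ ε * (v.1 - 1) := by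
      refine re_le_of_mem_segment hz ?_ ?_ <;>
      · simp only [latticePt]
        exact mul_le_mul_of_nonneg_left (by exact_mod_cast (by assumption)) hε.le
    linarith
  · have : z.im ≤ ε * (v.2 - 1) := by
      refine im_le_of_mem_segment hz ?_ ?_ <;>
      · simp only [latticePt]
        exact mul_le_mul_of_nonneg_left (by exact_mod_cast (by assumption)) hε.le
    linarith

/-- The factor -(1 - I) rotates the upper-right diagonal ray from q onto the negative real axis, the
cut of the principal logarithm. -/
theorem logSum_lattice_eq_sub (hε : 0 < ε) (hl : List.IsChain (LatticeStep ε D) (a :: (m ++ [b])))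
    (hv : ∀ p ∈ a :: (m ++ [b]), LexBelow v p) (hq : q ∈ latticeSquare ε v) (hqD : q ∉ D) :
    logSum q ((a :: (m ++ [b])).map (latticePt ε)) =
      log (-((latticePt ε b - q) * (1 - I))) - log (-((latticePt ε a - q) * (1 - I))) := by
  rw [List.map_cons, List.map_append, List.map_singleton]
  refine logSum_eq_sub_of_branch (W := {z | -((z - q) * (1 - I)) ∈ slitPlane})
    (g := fun z => log (-((z - q) * (1 - I)))) (c := -(1 - I))
    (ContinuousOn.clog (by fun_prop) fun z hz => hz) ?_ ?_ ?_
  · intro h; simpa using congrArg re h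
  · intro z hz
    rw [exp_log (slitPlane_ne_zero hz)]; ring
  · rw [← List.map_singleton, ← List.map_append, ← List.map_cons, List.isChain_map]
    exact hl.imp_of_mem_imp fun x y hx hy hxy => hxy.segment_subset_slit hε (hv x hx) (hv y hy) hq hqD

theorem logSum_cons_append_singleton (q a b : ℂ) (l : List ℂ) (c : ℂ) :
    logSum q (c :: a :: (l ++ [b, c])) =
      log ((a - q) / (c - q)) + logSum q (a :: (l ++ [b])) + log ((c - q) / (b - q)) := by
  rw [logSum, ← List.cons_append, logSum_append q b (a :: l) [c]]
  simp [logSum, add_assoc]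

/-- If a closed lattice path in `D` turns at its lexicographically largest vertex, which it visits
once, then the lattice square inside the turn is contained in `D`. -/
theorem latticeSquare_subset (hε : 0 < ε) (hSo : IsOpen S) (hS : IsSimplyConnected S)
    (hDS : D ⊆ S) (hDS' : HolesLeave D S)
    (hl : List.IsChain (LatticeStep ε D) (v :: a :: (m ++ [b, v])))
    (hv : ∀ p ∈ a :: (m ++ [b]), LexBelow v p) (hab : a ≠ b) : latticeSquare ε v ⊆ D := by
  intro q hq
  by_contra hqD
  have hl' : List.IsChain (LatticeStep ε D) (v :: ((a :: (m ++ [b])) ++ [v])) := by simpa using hl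
  have hva : LatticeStep ε D v a := (List.isChain_cons_cons.1 hl).1
  have hbv : LatticeStep ε D b v := by
    have : List.IsChain (LatticeStep ε D) ((v :: a :: m) ++ b :: [v]) := by simpa using hl
    simpa using this.right_of_append
  have hmid : List.IsChain (LatticeStep ε D) (a :: (m ++ [b])) :=
    ((List.isChain_cons_cons.1 hl').2).left_of_append
  have hzero : logSum q ((v :: a :: (m ++ [b, v])).map (latticePt ε)) = 0 := by
    have := logSum_eq_zero hSo hS hDS hDS' (a := latticePt ε v)
      (l := (a :: (m ++ [b])).map (latticePt ε)) (q := q) ?_ hqD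
    · rw [← this]; simp
    · have h2 := (List.isChain_map (R := fun x y => segment ℝ x y ⊆ D) (latticePt ε)).2
        (hl'.imp fun x y h => h.2)
      simpa using h2
  have hsum := logSum_cons_append_singleton q (latticePt ε a) (latticePt ε b)
    (m.map (latticePt ε)) (latticePt ε v)
  have hm := logSum_lattice_eq_sub hε hmid hv hq hqD
  simp only [List.map_cons, List.map_append, List.map_nil] at hzero hm
  rw [hzero, hm] at hsum
  have him := congrArg im hsum
  simp only [add_im, sub_im, zero_im] at him
  obtain ⟨q1, q2, q3, q4⟩ := hq
  have hav := hv a (by simp)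
  have hbv' := hv b (by simp)
  have hva1 := hva.1
  have hbv1 := hbv.1
  rw [abs_eq_max_neg, abs_eq_max_neg] at hva1 hbv1
  unfold LexBelow at hav hbv'
  -- Only the left and lower neighbours of v precede it lexicographically, so distinct neighbours on
  -- the path must be these two.
  have key : (a = (v.1 - 1, v.2) ∧ b = (v.1, v.2 - 1)) ∨
      (b = (v.1 - 1, v.2) ∧ a = (v.1, v.2 - 1)) := by
    have hab' : a.1 ≠ b.1 ∨ a.2 ≠ b.2 := by
      by_contra! h; exact hab (Prod.ext h.1 h.2)
    simp only [Prod.ext_iff]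
    omega
  -- The right and upper edges of the square belong to D, so q is not on them; this makes the sign
  -- inequalities below strict.
  have off : ∀ d l : ℤ × ℤ, l = (v.1 - 1, v.2) → d = (v.1, v.2 - 1) →
      segment ℝ (latticePt ε d) (latticePt ε v) ⊆ D →
      segment ℝ (latticePt ε l) (latticePt ε v) ⊆ D → q.re < ε * v.1 ∧ q.im < ε * v.2 := by
    rintro d l rfl rfl hd hl
    constructor
    · refine lt_of_le_of_ne q2 fun h => hqD (hd ?_)
      refine ⟨v.2 - q.im / ε, 1 - (v.2 - q.im / ε), ?_, ?_, by ring, ?_⟩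
      · rw [sub_nonneg, div_le_iff₀ hε]; linarith
      · rw [sub_nonneg, sub_le_comm, le_div_iff₀ hε]; linarith
      · apply Complex.ext
        · simp [latticePt, h]; ring
        · simp [latticePt]; field_simp; ring
    · refine lt_of_le_of_ne q4 fun h => hqD (hl ?_)
      refine ⟨v.1 - q.re / ε, 1 - (v.1 - q.re / ε), ?_, ?_, by ring, ?_⟩
      · rw [sub_nonneg, div_le_iff₀ hε]; linarith
      · rw [sub_nonneg, sub_le_comm, le_div_iff₀ hε]; linarith
      · apply Complex.ext
        · simp [latticePt]; field_simp; ring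
        · simp [latticePt, h]; ring
  have hX : ∀ x : ℝ, ε * (x - 1) = ε * x - ε := fun x => by ring
  rw [hX] at q1 q3
  -- The two edges at v and the branch difference contribute imaginary parts of one common sign, so
  -- the total cannot be zero.
  have i3 : q.re < ε * v.1 → q.im < ε * v.2 →
      0 < (log (-((latticePt ε (v.1, v.2 - 1) - q) * (1 - I)))).im := by
    intro h1 h2
    refine log_im_pos ?_
    simp [latticePt, hX]
    linarith
  have i4 : q.re < ε * v.1 → q.im < ε * v.2 →
      (log (-((latticePt ε (v.1 - 1, v.2) - q) * (1 - I)))).im < 0 := by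
    intro h1 h2
    refine log_im_neg ?_
    simp [latticePt, hX]
    linarith
  rcases key with ⟨rfl, rfl⟩ | ⟨rfl, rfl⟩
  · obtain ⟨o1, o2⟩ := off _ _ rfl rfl hbv.2 (segment_symm ℝ (latticePt ε v) _ ▸ hva.2)
    have i1 : 0 < (log ((latticePt ε (v.1 - 1, v.2) - q) / (latticePt ε v - q))).im := by
      refine log_div_im_pos ((mul_pos hε (sub_pos.2 o2)).trans_eq ?_)
      simp [latticePt]; ring
    have i2 : 0 < (log ((latticePt ε v - q) / (latticePt ε (v.1, v.2 - 1) - q))).im := by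
      refine log_div_im_pos ((mul_pos hε (sub_pos.2 o1)).trans_eq ?_)
      simp [latticePt]; ring
    linarith [i3 o1 o2, i4 o1 o2]
  · obtain ⟨o1, o2⟩ := off _ _ rfl rfl (segment_symm ℝ (latticePt ε v) _ ▸ hva.2) hbv.2
    have i1 : (log ((latticePt ε (v.1, v.2 - 1) - q) / (latticePt ε v - q))).im < 0 := by
      refine log_div_im_neg (neg_pos.1 ((mul_pos hε (sub_pos.2 o1)).trans_eq ?_))
      simp [latticePt]; ring
    have i2 : (log ((latticePt ε v - q) / (latticePt ε (v.1 - 1, v.2) - q))).im < 0 := by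
      refine log_div_im_neg (neg_pos.1 ((mul_pos hε (sub_pos.2 o2)).trans_eq ?_))
      simp [latticePt]; ring
    linarith [i3 o1 o2, i4 o1 o2]
end

/-! ### Multiplicative cocycles on closed lattice paths -/

section
variable {α Γ : Type*} [Group Γ]

/-- The product of a two-variable function along consecutive entries of a list. -/
def chainProd (e : α → α → Γ) : List α → Γ
  | a :: b :: t => e a b * chainProd e (b :: t)
  | _ => 1

theorem chainProd_append (e : α → α → Γ) (a : α) (l₁ l₂ : List α) :
    chainProd e (l₁ ++ a :: l₂) = chainProd e (l₁ ++ [a]) * chainProd e (a :: l₂) := by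
  induction l₁ with
  | nil => simp [chainProd]
  | cons x t ih => cases t <;> simp_all [chainProd, mul_assoc]

theorem chainProd_cons_append_singleton (e : α → α → Γ) (v a b : α) (m : List α) :
    chainProd e (v :: a :: (m ++ [b, v])) = e v a * chainProd e (a :: (m ++ [b])) * e b v := by
  rw [chainProd, ← List.cons_append, chainProd_append e b (a :: m) [v]]
  simp [chainProd, mul_assoc]

/-- A function on pairs of points of the plane that is multiplicative on triangles in `D`. -/
def IsTriangleCocycle (D : Set ℂ) (e : ℂ → ℂ → Γ) : Prop :=
  ∀ a b c, convexHull ℝ {a, b, c} ⊆ D → e a b * e b c = e a c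

namespace IsTriangleCocycle
variable {D : Set ℂ} {e : ℂ → ℂ → Γ}

theorem mul_of_convex (he : IsTriangleCocycle D e) {C : Set ℂ} (hC : Convex ℝ C) (hCD : C ⊆ D)
    {a b c : ℂ} (ha : a ∈ C) (hb : b ∈ C) (hc : c ∈ C) : e a b * e b c = e a c :=
  he a b c ((convexHull_min (by grind) hC).trans hCD)

theorem self (he : IsTriangleCocycle D e) {a : ℂ} (ha : a ∈ D) : e a a = 1 := by
  have := he.mul_of_convex (convex_singleton a) (singleton_subset_iff.2 ha) rfl rfl rfl
  simpa using this

theorem mul_symm (he : IsTriangleCocycle D e) {a b : ℂ} (h : segment ℝ a b ⊆ D) :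
    e a b * e b a = 1 := by
  rw [he.mul_of_convex (convex_segment a b) h (left_mem_segment ℝ a b) (right_mem_segment ℝ a b)
    (left_mem_segment ℝ a b), he.self (h (left_mem_segment ℝ a b))]

end IsTriangleCocycle

theorem convex_latticeSquare (ε : ℝ) (v : ℤ × ℤ) : Convex ℝ (latticeSquare ε v) :=
  (convex_halfSpace_re_ge _).inter ((convex_halfSpace_re_le _).inter
    ((convex_halfSpace_im_ge _).inter (convex_halfSpace_im_le _)))

/-- The weight of a lattice point relative to a lower left corner. -/
def latticeWeight (o p : ℤ × ℤ) : ℕ := (1 + (p.1 - o.1) + (p.2 - o.2)).toNat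

theorem exists_lexBelow (p₀ : ℤ × ℤ) (l : List (ℤ × ℤ)) :
    ∃ v ∈ p₀ :: l, ∀ p ∈ p₀ :: l, p = v ∨ LexBelow v p := by
  obtain ⟨v, hv, hmax⟩ := (p₀ :: l).toFinset.exists_max_image toLex ⟨p₀, by simp⟩
  refine ⟨v, by simpa using hv, fun p hp => ?_⟩
  have := hmax p (List.mem_toFinset.2 hp)
  rw [Prod.Lex.toLex_le_toLex] at this
  unfold LexBelow
  rw [Prod.ext_iff]
  omega

variable {ε : ℝ} {D S : Set ℂ} {e : ℂ → ℂ → Γ}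

/-- A multiplicative cocycle on `D` is trivial on closed lattice paths in `D`. -/
theorem chainProd_lattice_eq_one (hε : 0 < ε) (hSo : IsOpen S) (hS : IsSimplyConnected S)
    (hDS : D ⊆ S) (hDS' : HolesLeave D S) (he : IsTriangleCocycle D e) (o : ℤ × ℤ) (n : ℕ) :
    ∀ (p : ℤ × ℤ) (l : List (ℤ × ℤ)), ((p :: l).map (latticeWeight o)).sum = n →
      (∀ x ∈ p :: l, o.1 ≤ x.1 ∧ o.2 ≤ x.2) →
      List.IsChain (LatticeStep ε D) (p :: (l ++ [p])) →
      chainProd (fun x y => e (latticePt ε x) (latticePt ε y)) (p :: (l ++ [p])) = 1 := by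
  induction n using Nat.strong_induction_on with
  | _ n ih =>
  set E : ℤ × ℤ → ℤ × ℤ → Γ := fun x y => e (latticePt ε x) (latticePt ε y)
  -- The summand 1 in the weight makes every vertex count, so deleting vertices decreases the total.
  have hwt : ∀ x : ℤ × ℤ, (o.1 ≤ x.1 ∧ o.2 ≤ x.2) → 1 ≤ latticeWeight o x := fun x hx => by
    unfold latticeWeight; omega
  -- the case of a lexicographically largest initial vertex
  have main : ∀ (v : ℤ × ℤ) (l : List (ℤ × ℤ)), ((v :: l).map (latticeWeight o)).sum = n →
      (∀ x ∈ v :: l, o.1 ≤ x.1 ∧ o.2 ≤ x.2) →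
      List.IsChain (LatticeStep ε D) (v :: (l ++ [v])) →
      (∀ x ∈ v :: l, x = v ∨ LexBelow v x) → chainProd E (v :: (l ++ [v])) = 1 := by
    intro v l hn ho hl hv
    by_cases hvl : v ∈ l
    · obtain ⟨l₁, l₂, rfl⟩ := List.append_of_mem hvl
      have hl' : List.IsChain (LatticeStep ε D) ((v :: l₁) ++ v :: (l₂ ++ [v])) := by
        simpa using hl
      rw [List.isChain_split] at hl'
      have hsplit : chainProd E (v :: (l₁ ++ v :: l₂ ++ [v])) =
          chainProd E (v :: (l₁ ++ [v])) * chainProd E (v :: (l₂ ++ [v])) := by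
        simpa using chainProd_append E v (v :: l₁) (l₂ ++ [v])
      have := hwt v (ho v (by simp))
      simp only [List.map_cons, List.map_append, List.sum_cons, List.sum_append] at hn
      rw [hsplit, ih _ ?_ v l₁ rfl (fun x hx => ho x (by simp at hx ⊢; tauto)) (by simpa using hl'.1),
        ih _ ?_ v l₂ rfl (fun x hx => ho x (by simp at hx ⊢; tauto)) hl'.2, one_mul]
      all_goals simp only [List.map_cons, List.sum_cons]; omega
    have hv' : ∀ x ∈ l, LexBelow v x := fun x hx =>
      (hv x (List.mem_cons_of_mem _ hx)).resolve_left fun h => hvl (h ▸ hx)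
    rcases l with - | ⟨a, l⟩
    · have := (List.isChain_pair.1 hl).2
      simp [chainProd, E, he.self (this (left_mem_segment ℝ _ _))]
    have hva : LatticeStep ε D v a := (List.isChain_cons_cons.1 hl).1
    rcases List.eq_nil_or_concat l with rfl | ⟨m, b, rfl⟩
    · simp [chainProd, E, he.mul_symm hva.2]
    rw [List.concat_eq_append] at *
    have hl₂ : List.IsChain (LatticeStep ε D) (v :: a :: (m ++ [b, v])) := by simpa using hl
    have hbv : LatticeStep ε D b v := by
      have : List.IsChain (LatticeStep ε D) ((v :: a :: m) ++ b :: [v]) := by simpa using hl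
      simpa using this.right_of_append
    have hmid : List.IsChain (LatticeStep ε D) (a :: (m ++ [b])) := by
      have : List.IsChain (LatticeStep ε D) (v :: ((a :: (m ++ [b])) ++ [v])) := by simpa using hl
      exact ((List.isChain_cons_cons.1 this).2).left_of_append
    have hform : v :: (a :: (m ++ [b]) ++ [v]) = v :: a :: (m ++ [b, v]) := by simp
    rw [hform, chainProd_cons_append_singleton]
    have hwv := hwt v (ho v (by simp))
    simp only [List.map_cons, List.map_append, List.map_nil, List.sum_cons, List.sum_append,
      List.sum_nil] at hn
    by_cases hab : a = b
    · subst hab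
      rw [ih _ ?_ a m rfl (fun x hx => ho x (by simp at hx ⊢; tauto)) hmid, mul_one]
      · exact he.mul_symm hva.2
      · simp only [List.map_cons, List.sum_cons]; omega
    · have hsq := latticeSquare_subset hε hSo hS hDS hDS' hl₂ hv' hab
      -- Replacing v by the opposite corner leaves the product trivial or nontrivial as before,
      -- since the square is convex and lies in D, and it lowers the weight.
      set u : ℤ × ℤ := (v.1 - 1, v.2 - 1) with hu
      have hav := hv' a (by simp)
      have hbv' := hv' b (by simp)
      have hva1 := hva.1
      have hbv1 := hbv.1
      rw [abs_eq_max_neg, abs_eq_max_neg] at hva1 hbv1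
      unfold LexBelow at hav hbv'
      have key : (a = (v.1 - 1, v.2) ∧ b = (v.1, v.2 - 1)) ∨
          (b = (v.1 - 1, v.2) ∧ a = (v.1, v.2 - 1)) := by
        have hab' : a.1 ≠ b.1 ∨ a.2 ≠ b.2 := by
          by_contra! h; exact hab (Prod.ext h.1 h.2)
        simp only [Prod.ext_iff]
        omega
      have hmem : ∀ x : ℤ × ℤ, v.1 - 1 ≤ x.1 → x.1 ≤ v.1 → v.2 - 1 ≤ x.2 → x.2 ≤ v.2 →
          latticePt ε x ∈ latticeSquare ε v := fun x h1 h2 h3 h4 =>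
        ⟨mul_le_mul_of_nonneg_left (by exact_mod_cast h1) hε.le,
          mul_le_mul_of_nonneg_left (by exact_mod_cast h2) hε.le,
          mul_le_mul_of_nonneg_left (by exact_mod_cast h3) hε.le,
          mul_le_mul_of_nonneg_left (by exact_mod_cast h4) hε.le⟩
      have hmv := hmem v (by omega) le_rfl (by omega) le_rfl
      have hmu := hmem u (by simp [u]) (by simp [u]) (by simp [u]) (by simp [u])
      have hma : latticePt ε a ∈ latticeSquare ε v := by
        rcases key with ⟨rfl, -⟩ | ⟨-, rfl⟩ <;> apply hmem <;> simp
      have hmb : latticePt ε b ∈ latticeSquare ε v := by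
        rcases key with ⟨-, rfl⟩ | ⟨rfl, -⟩ <;> apply hmem <;> simp
      have hconv := convex_latticeSquare ε v
      have hua : LatticeStep ε D u a := ⟨by
        rcases key with ⟨rfl, -⟩ | ⟨-, rfl⟩ <;> simp [u],
        (hconv.segment_subset hmu hma).trans hsq⟩
      have hbu : LatticeStep ε D b u := ⟨by
        rcases key with ⟨-, rfl⟩ | ⟨rfl, -⟩ <;> simp [u],
        (hconv.segment_subset hmb hmu).trans hsq⟩
      have hoa := ho a (by simp)
      have hob := ho b (by simp)
      have hou : o.1 ≤ u.1 ∧ o.2 ≤ u.2 := by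
        rcases key with ⟨rfl, rfl⟩ | ⟨rfl, rfl⟩ <;> simp only [u] <;> omega
      have hwu : latticeWeight o u < latticeWeight o v := by
        unfold latticeWeight
        simp only [u] at hou ⊢
        omega
      have hu1 := ih _ ?_ u (a :: (m ++ [b])) rfl (fun x hx => ?_) ?_
      · rw [show u :: (a :: (m ++ [b]) ++ [u]) = u :: a :: (m ++ [b, u]) by simp,
          chainProd_cons_append_singleton] at hu1
        have e1 : E b v * E v a = E b u * E u a :=
          (he.mul_of_convex hconv hsq hmb hmv hma).trans
            (he.mul_of_convex hconv hsq hmb hmu hma).symm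
        rw [mul_assoc, mul_eq_one_comm, mul_assoc] at hu1 ⊢
        rw [e1]
        exact hu1
      · simp only [List.map_cons, List.map_append, List.map_nil, List.sum_cons, List.sum_append,
          List.sum_nil]
        omega
      · rcases List.mem_cons.1 hx with rfl | hx
        · exact hou
        · exact ho x (List.mem_cons_of_mem _ (by simpa using hx))
      · have h1 : List.IsChain (LatticeStep ε D) ((a :: m) ++ b :: [u]) :=
          List.isChain_split.2 ⟨by simpa using hmid, by simpa using hbu⟩
        have h2 : List.IsChain (LatticeStep ε D) (u :: a :: (m ++ [b, u])) :=
          List.isChain_cons_cons.2 ⟨hua, by simpa using h1⟩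
        simpa using h2
  -- The loop is rotated to start at its largest vertex. Rotation swaps the two factors of the
  -- product, which does not affect whether it is 1.
  intro p l hn ho hl
  obtain ⟨v, hvm, hv⟩ := exists_lexBelow p l
  obtain ⟨s, t, hst⟩ := List.append_of_mem hvm
  rcases s with - | ⟨p', s⟩
  · obtain ⟨rfl, rfl⟩ : p = v ∧ l = t := by simpa using hst
    exact main p l hn ho hl hv
  · obtain ⟨rfl, rfl⟩ : p = p' ∧ l = s ++ v :: t := by simpa using hst
    have hl' : List.IsChain (LatticeStep ε D) ((p :: s) ++ v :: (t ++ [p])) := by simpa using hl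
    rw [List.isChain_split] at hl'
    have h1 : chainProd E (v :: ((t ++ p :: s) ++ [v])) = 1 := by
      refine main v (t ++ p :: s) ?_ (fun x hx => ho x ?_) ?_ fun x hx => hv x ?_
      · rw [← hn]; simp; ring
      · simp at hx ⊢; tauto
      · have : List.IsChain (LatticeStep ε D) ((v :: t) ++ p :: (s ++ [v])) :=
          List.isChain_split.2 ⟨by simpa using hl'.2, by simpa using hl'.1⟩
        simpa using this
      · simp at hx ⊢; tauto
    have h2 := chainProd_append E p (v :: t) (s ++ [v])
    have h3 := chainProd_append E v (p :: s) (t ++ [p])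
    simp only [List.cons_append, List.append_assoc] at h1 h2 h3 ⊢
    rw [h1] at h2
    rw [h3]
    exact mul_eq_one_comm.1 h2.symm
end

/-! ### Fundamental group and lattice approximation of paths -/

section
variable {X : Type*} [TopologicalSpace X] {x₀ : X} (c : ∀ x, Path.Homotopic.Quotient x₀ x)

/-- The element of the fundamental group defined by a homotopy class of paths, closing it up by
the reference paths `c`. -/
noncomputable def pathElt {a b : X} (p : Path.Homotopic.Quotient a b) : FundamentalGroup X x₀ :=
  FundamentalGroup.fromPath ((c b).trans (p.symm.trans (c a).symm))

theorem Path.Homotopic.Quotient.symm_trans_rev {a b d : X} (p : Path.Homotopic.Quotient a b)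
    (q : Path.Homotopic.Quotient b d) : (p.trans q).symm = q.symm.trans p.symm := by
  induction p using Path.Homotopic.Quotient.ind with | mk p =>
  induction q using Path.Homotopic.Quotient.ind with | mk q =>
  simp only [← Path.Homotopic.Quotient.mk_trans, ← Path.Homotopic.Quotient.mk_symm,
    Path.trans_symm]

/-- Multiplication in `FundamentalGroup` concatenates in reverse order; the inversion of the path in
`pathElt` compensates for this. -/
theorem pathElt_trans {a b d : X} (p : Path.Homotopic.Quotient a b)
    (q : Path.Homotopic.Quotient b d) : pathElt c (p.trans q) = pathElt c p * pathElt c q := by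
  rw [FundamentalGroup.mul_def]
  change (c d).trans ((p.trans q).symm.trans (c a).symm) =
    ((c d).trans (q.symm.trans (c b).symm)).trans ((c b).trans (p.symm.trans (c a).symm))
  simp only [Path.Homotopic.Quotient.symm_trans_rev, Path.Homotopic.Quotient.trans_assoc]
  rw [← Path.Homotopic.Quotient.trans_assoc (c b).symm, Path.Homotopic.Quotient.symm_trans,
    Path.Homotopic.Quotient.refl_trans]

theorem pathElt_refl (a : X) : pathElt c (Path.Homotopic.Quotient.refl a) = 1 := by
  have := pathElt_trans c (Path.Homotopic.Quotient.refl a) (Path.Homotopic.Quotient.refl a)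
  rw [Path.Homotopic.Quotient.trans_refl] at this
  exact left_eq_mul.1 this

theorem eq_refl_of_pathElt_eq_one {a : X} {p : Path.Homotopic.Quotient a a}
    (h : pathElt c p = 1) : p = Path.Homotopic.Quotient.refl a := by
  rw [FundamentalGroup.one_def] at h
  have h1 : (c a).trans (p.symm.trans (c a).symm) = Path.Homotopic.Quotient.refl x₀ := h
  have h2 : (c a).symm.trans (((c a).trans (p.symm.trans (c a).symm)).trans (c a)) = p.symm := by
    simp only [Path.Homotopic.Quotient.trans_assoc, Path.Homotopic.Quotient.symm_trans,
      Path.Homotopic.Quotient.trans_refl]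
    rw [← Path.Homotopic.Quotient.trans_assoc, Path.Homotopic.Quotient.symm_trans,
      Path.Homotopic.Quotient.refl_trans]
  rw [h1, Path.Homotopic.Quotient.refl_trans, Path.Homotopic.Quotient.symm_trans] at h2
  have h3 := Path.Homotopic.Quotient.trans_symm p
  rwa [← h2, Path.Homotopic.Quotient.trans_refl] at h3

theorem pathElt_cast {a b a' b' : X} (p : Path a b) (ha : a' = a) (hb : b' = b) :
    pathElt c (Path.Homotopic.Quotient.mk (p.cast ha hb)) = pathElt c (.mk p) := by
  subst ha hb; rfl
end

/-- The convex set is contractible, so the paths are homotopic inside it; the inclusion carries the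
homotopy to D. -/
theorem homotopic_of_range_subset_convex {D C : Set ℂ} (hC : Convex ℝ C) (hCD : C ⊆ D) {a b : D}
    {p q : Path a b} (hp : ∀ t, (p t : ℂ) ∈ C) (hq : ∀ t, (q t : ℂ) ∈ C) : p.Homotopic q := by
  have ha : (a : ℂ) ∈ C := by simpa using hp 0
  have hb : (b : ℂ) ∈ C := by simpa using hp 1
  have := hC.contractibleSpace ⟨a, ha⟩
  let f : C(C, D) := ⟨inclusion hCD, continuous_inclusion hCD⟩
  let p' : Path (⟨a, ha⟩ : C) ⟨b, hb⟩ :=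
    ⟨⟨fun t => ⟨p t, hp t⟩, by fun_prop⟩, by simp, by simp⟩
  let q' : Path (⟨a, ha⟩ : C) ⟨b, hb⟩ :=
    ⟨⟨fun t => ⟨q t, hq t⟩, by fun_prop⟩, by simp, by simp⟩
  exact (SimplyConnectedSpace.paths_homotopic p' q').map f

/-- The straight path between two points in a set containing the segment between them. -/
noncomputable def segmentPath {D : Set ℂ} {a b : ℂ} (h : segment ℝ a b ⊆ D) :
    Path (⟨a, h (left_mem_segment ℝ a b)⟩ : D) ⟨b, h (right_mem_segment ℝ a b)⟩ where
  toFun t := ⟨AffineMap.lineMap a b (t : ℝ), h (by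
    rw [segment_eq_image_lineMap]; exact mem_image_of_mem _ t.2)⟩
  continuous_toFun := by
    refine Continuous.subtype_mk ?_ _
    exact AffineMap.lineMap_continuous.comp continuous_subtype_val
  source' := by simp
  target' := by simp

theorem segmentPath_mem {D : Set ℂ} {a b : ℂ} (h : segment ℝ a b ⊆ D) (t : unitInterval) :
    (segmentPath h t : ℂ) ∈ segment ℝ a b := by
  rw [segment_eq_image_lineMap]; exact mem_image_of_mem _ t.2

section
variable {D : Set ℂ} {x₀ : D} (c : ∀ x : D, Path.Homotopic.Quotient x₀ x)

open scoped Classical in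
/-- The cocycle with values in the fundamental group given by straight paths. -/
noncomputable def segmentCocycle (a b : ℂ) : FundamentalGroup D x₀ :=
  if h : segment ℝ a b ⊆ D then pathElt c (.mk (segmentPath h)) else 1

theorem pathElt_eq_segmentCocycle {C : Set ℂ} (hC : Convex ℝ C) (hCD : C ⊆ D) {a b : D}
    {p : Path a b} (hp : ∀ t, (p t : ℂ) ∈ C) : pathElt c (.mk p) = segmentCocycle c a b := by
  have ha : (a : ℂ) ∈ C := by simpa using hp 0
  have hb : (b : ℂ) ∈ C := by simpa using hp 1
  have hs := hC.segment_subset ha hb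
  rw [segmentCocycle, dif_pos (hs.trans hCD)]
  congr 1
  exact Path.Homotopic.Quotient.eq.2 (homotopic_of_range_subset_convex hC hCD hp fun t =>
    hs (segmentPath_mem _ t))

theorem isTriangleCocycle_segmentCocycle : IsTriangleCocycle D (segmentCocycle c) := by
  intro a b d h
  have hC := convex_convexHull ℝ ({a, b, d} : Set ℂ)
  have ha : a ∈ convexHull ℝ ({a, b, d} : Set ℂ) := subset_convexHull ℝ _ (by simp)
  have hb : b ∈ convexHull ℝ ({a, b, d} : Set ℂ) := subset_convexHull ℝ _ (by simp)
  have hd : d ∈ convexHull ℝ ({a, b, d} : Set ℂ) := subset_convexHull ℝ _ (by simp)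
  have h1 := hC.segment_subset ha hb
  have h2 := hC.segment_subset hb hd
  have := pathElt_eq_segmentCocycle c hC h
    (p := (segmentPath (h1.trans h)).trans (segmentPath (h2.trans h))) (by
      intro t
      rw [Path.trans_apply]
      split_ifs
      · exact h1 (segmentPath_mem _ _)
      · exact h2 (segmentPath_mem _ _))
  rw [← this, Path.Homotopic.Quotient.mk_trans, pathElt_trans,
    segmentCocycle, dif_pos (h1.trans h), segmentCocycle, dif_pos (h2.trans h)]

/-- The lower left corner of the lattice square containing `z`. -/
noncomputable def latticeFloor (ε : ℝ) (z : ℂ) : ℤ × ℤ := (⌊z.re / ε⌋, ⌊z.im / ε⌋)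

theorem latticeFloor_bounds {ε : ℝ} (hε : 0 < ε) (x : ℝ) :
    0 ≤ x - ε * ⌊x / ε⌋ ∧ x - ε * ⌊x / ε⌋ < ε := by
  have h1 := Int.floor_le (x / ε)
  have h2 := Int.lt_floor_add_one (x / ε)
  rw [le_div_iff₀ hε] at h1
  rw [div_lt_iff₀ hε] at h2
  constructor <;> linarith

theorem abs_floor_sub_floor_le {x y : ℝ} (h : |x - y| < 1) : |⌊x⌋ - ⌊y⌋| ≤ 1 := by
  rw [abs_lt] at h
  have h1 := Int.floor_le x
  have h2 := Int.lt_floor_add_one x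
  have h3 := Int.floor_le y
  have h4 := Int.lt_floor_add_one y
  have h5 : ⌊x⌋ < ⌊y⌋ + 2 := by
    have : (⌊x⌋ : ℝ) < ⌊y⌋ + 2 := by linarith
    exact_mod_cast this
  have h6 : ⌊y⌋ < ⌊x⌋ + 2 := by
    have : (⌊y⌋ : ℝ) < ⌊x⌋ + 2 := by linarith
    exact_mod_cast this
  rw [abs_le]; omega

theorem dist_lt_of_abs_re_im {z w : ℂ} {r s : ℝ} (h1 : |z.re - w.re| < r) (h2 : |z.im - w.im| < s) :
    dist z w < r + s := by
  rw [dist_eq_norm]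
  refine (norm_le_abs_re_add_abs_im (z - w)).trans_lt ?_
  rw [sub_re, sub_im]; linarith

/-- Every path is homotopic to a lattice path, up to straight segments at the ends. -/
theorem exists_lattice_path (hD : IsOpen D) {a b : D} (γ : Path a b) :
    ∃ ε > 0, ∃ l : List (ℤ × ℤ),
      segment ℝ (latticePt ε (latticeFloor ε a)) a ⊆ D ∧
      List.IsChain (LatticeStep ε D) (latticeFloor ε a :: (l ++ [latticeFloor ε b])) ∧
      chainProd (fun x y => segmentCocycle c (latticePt ε x) (latticePt ε y))
        (latticeFloor ε a :: (l ++ [latticeFloor ε b])) =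
      segmentCocycle c (latticePt ε (latticeFloor ε a)) a * pathElt c (.mk γ) *
        segmentCocycle c b (latticePt ε (latticeFloor ε b)) := by
  have he := isTriangleCocycle_segmentCocycle c
  have hγc : Continuous fun t => (γ t : ℂ) := continuous_subtype_val.comp γ.continuous
  obtain ⟨δ, hδ, hδD⟩ := (isCompact_range hγc).exists_thickening_subset_open hD (by
    rintro _ ⟨t, rfl⟩; exact (γ t).2)
  -- All lattice points used near a time s lie within 5ε of the path point, so 8ε leaves room.
  set ε := δ / 8
  have hε : 0 < ε := by positivity
  have hball : ∀ t, Metric.ball (γ t : ℂ) δ ⊆ D := fun t => by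
    refine subset_trans (fun z hz => ?_) hδD
    exact Metric.mem_thickening_iff.2 ⟨_, mem_range_self t, hz⟩
  obtain ⟨η, hη, hunif⟩ := Metric.uniformContinuous_iff.1
    (CompactSpace.uniformContinuous_of_continuous hγc) ε hε
  set v : unitInterval → ℤ × ℤ := fun t => latticeFloor ε (γ t)
  set E : ℤ × ℤ → ℤ × ℤ → FundamentalGroup D x₀ :=
    fun x y => segmentCocycle c (latticePt ε x) (latticePt ε y)
  have hfl : ∀ t, |(latticePt ε (v t)).re - (γ t : ℂ).re| < ε + ε / 8 ∧
      |(latticePt ε (v t)).im - (γ t : ℂ).im| < ε + ε / 8 := fun t => by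
    have h1 := latticeFloor_bounds hε (γ t : ℂ).re
    have h2 := latticeFloor_bounds hε (γ t : ℂ).im
    simp only [v, latticePt, latticeFloor, abs_lt]
    refine ⟨⟨?_, ?_⟩, ?_, ?_⟩ <;> linarith
  have hvball : ∀ t, latticePt ε (v t) ∈ Metric.ball (γ t : ℂ) δ := fun t => by
    have := dist_lt_of_abs_re_im (hfl t).1 (hfl t).2
    rw [Metric.mem_ball]
    have : δ = 8 * ε := by simp only [ε]; ring
    linarith
  -- The approximation is propagated along the path by showing that the good times form a nonempty
  -- clopen set.
  let Q : unitInterval → Prop := fun t => ∃ l : List (ℤ × ℤ),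
      List.IsChain (LatticeStep ε D) (v 0 :: (l ++ [v t])) ∧
      chainProd E (v 0 :: (l ++ [v t])) =
      segmentCocycle c (latticePt ε (v 0)) (γ 0) * pathElt c (.mk (γ.subpath 0 t)) *
        segmentCocycle c (γ t) (latticePt ε (v t))
  have hself : ∀ t, segment ℝ (latticePt ε (v t)) (γ t) ⊆ D := fun t =>
    ((convex_ball _ δ).segment_subset (hvball t) (Metric.mem_ball_self hδ)).trans (hball t)
  have hQ0 : Q 0 := by
    refine ⟨[], ?_, ?_⟩
    · rw [List.nil_append, List.isChain_pair]
      refine ⟨by simp, ?_⟩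
      rw [segment_same]
      exact singleton_subset_iff.2 (hself 0 (left_mem_segment ℝ _ _))
    · rw [Path.subpath_self, Path.Homotopic.Quotient.mk_refl, pathElt_refl, mul_one,
        he.mul_symm (hself 0)]
      simp [chainProd, E, he.self (hself 0 (left_mem_segment ℝ _ _))]
  have hstep : ∀ s t, dist s t < η → Q s → Q t := by
    rintro s t hst ⟨l, hl, hprod⟩
    -- Both floor coordinates may change between s and t; passing through this corner makes each
    -- move a single lattice step.
    set w : ℤ × ℤ := ((v t).1, (v s).2)
    set B := Metric.ball (γ s : ℂ) δ
    have hBc : Convex ℝ B := convex_ball _ _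
    have hBD : B ⊆ D := hball s
    have hzs : (γ s : ℂ) ∈ B := Metric.mem_ball_self hδ
    have hd : dist (γ s : ℂ) (γ t) < ε := hunif hst
    have hδε : δ = 8 * ε := by simp only [ε]; ring
    have hzt : (γ t : ℂ) ∈ B := by rw [Metric.mem_ball, dist_comm]; linarith
    have hre : |(γ s : ℂ).re - (γ t : ℂ).re| < ε := by
      rw [← sub_re]; rw [dist_eq_norm] at hd; exact (abs_re_le_norm _).trans_lt hd
    have him : |(γ s : ℂ).im - (γ t : ℂ).im| < ε := by
      rw [← sub_im]; rw [dist_eq_norm] at hd; exact (abs_im_le_norm _).trans_lt hd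
    have hPs : latticePt ε (v s) ∈ B := hvball s
    have hPt : latticePt ε (v t) ∈ B := by
      have := dist_lt_of_abs_re_im (hfl t).1 (hfl t).2
      rw [Metric.mem_ball]
      have := dist_triangle (latticePt ε (v t)) (γ t) (γ s)
      rw [dist_comm (γ t : ℂ)] at this
      linarith
    have hW : latticePt ε w ∈ B := by
      have h1 := (hfl t).1
      have h2 := (hfl s).2
      have : dist (latticePt ε w) (γ s) < 3 * ε + 2 * ε := by
        refine dist_lt_of_abs_re_im ?_ ?_
        · rw [abs_lt] at h1 hre ⊢
          have e : (latticePt ε w).re = (latticePt ε (v t)).re := rfl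
          rw [e]
          constructor <;> linarith [h1.1, h1.2, hre.1, hre.2]
        · have e : (latticePt ε w).im = (latticePt ε (v s)).im := rfl
          rw [e]; linarith
      rw [Metric.mem_ball]; linarith
    have hfloor : ∀ x y : ℝ, |x - y| < ε → |⌊x / ε⌋ - ⌊y / ε⌋| ≤ 1 := fun x y hxy => by
      refine abs_floor_sub_floor_le ?_
      rw [← sub_div, abs_div, abs_of_pos hε, div_lt_one hε]; exact hxy
    have hsw : LatticeStep ε D (v s) w := by
      refine ⟨?_, (hBc.segment_subset hPs hW).trans hBD⟩
      simpa [w, v, latticeFloor] using hfloor _ _ hre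
    have hwt : LatticeStep ε D w (v t) := by
      refine ⟨?_, (hBc.segment_subset hW hPt).trans hBD⟩
      simpa [w, v, latticeFloor] using hfloor _ _ him
    refine ⟨l ++ [v s, w], ?_, ?_⟩
    · have h1 : List.IsChain (LatticeStep ε D) ((v 0 :: l) ++ v s :: [w, v t]) :=
        List.isChain_split.2 ⟨by simpa using hl, by simp [hsw, hwt]⟩
      simpa using h1
    · have h1 := chainProd_append E (v s) (v 0 :: l) [w, v t]
      have h2 : chainProd E [v s, w, v t] = E (v s) w * E w (v t) := by simp [chainProd]
      have h3 : pathElt c (.mk (γ.subpath 0 t)) =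
          pathElt c (.mk (γ.subpath 0 s)) * segmentCocycle c (γ s) (γ t) := by
        rw [← Path.Homotopic.Quotient.eq.2 ⟨Path.Homotopy.subpathTransSubpath γ 0 s t⟩,
          Path.Homotopic.Quotient.mk_trans, pathElt_trans,
          pathElt_eq_segmentCocycle c hBc hBD (p := γ.subpath s t)]
        intro r
        have hr : γ.subpath s t r ∈ range (γ.subpath s t) := mem_range_self r
        rw [Path.range_subpath] at hr
        obtain ⟨r', hr', hrr⟩ := hr
        rw [← hrr, Metric.mem_ball]
        have : dist r' s < η := by
          refine lt_of_le_of_lt ?_ hst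
          rw [dist_comm]
          refine Real.dist_left_le_of_mem_uIcc ?_
          rw [mem_uIcc] at hr' ⊢
          exact_mod_cast hr'
        have := hunif this
        linarith
      have h4 : E (v s) w * E w (v t) =
          segmentCocycle c (latticePt ε (v s)) (latticePt ε (v t)) :=
        he.mul_of_convex hBc hBD hPs hW hPt
      have h5 := he.mul_of_convex hBc hBD hzs hPs hPt
      have h6 := he.mul_of_convex hBc hBD hzs hzt hPt
      have h7 : v 0 :: (l ++ [v s, w] ++ [v t]) = (v 0 :: l) ++ v s :: [w, v t] := by simp
      rw [h7, h1, h2, h4, List.cons_append, hprod, h3, mul_assoc, h5, ← h6]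
      simp only [mul_assoc]
  have hopen : IsOpen {t | Q t} := Metric.isOpen_iff.2 fun t ht =>
    ⟨η, hη, fun s hs => hstep t s (by rwa [dist_comm]) ht⟩
  have hclosed : IsClosed {t | Q t} := ⟨Metric.isOpen_iff.2 fun t ht =>
    ⟨η, hη, fun s hs hQs => ht (hstep s t hs hQs)⟩⟩
  have huniv := IsClopen.eq_univ ⟨hclosed, hopen⟩ ⟨0, hQ0⟩
  obtain ⟨l, h1, h2⟩ : Q 1 := by
    have : (1 : unitInterval) ∈ {t | Q t} := by rw [huniv]; trivial
    exact this
  refine ⟨ε, hε, l, ?_⟩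
  have h3 := hself 0
  rw [Path.subpath_zero_one, pathElt_cast] at h2
  simp only [v, γ.source, γ.target] at h1 h2 h3
  exact ⟨h3, h1, h2⟩
end

/-- A plane domain whose complement has no bounded component contained in a simply connected
domain `S ⊇ D` is simply connected. -/
theorem isSimplyConnected_of_holesLeave {D S : Set ℂ} (hD : IsOpen D) (hDc : IsConnected D)
    (hSo : IsOpen S) (hS : IsSimplyConnected S) (hDS : D ⊆ S) (hDS' : HolesLeave D S) :
    IsSimplyConnected D := by
  have hpc : IsPathConnected D := hD.isConnected_iff_isPathConnected.1 hDc
  have := isPathConnected_iff_pathConnectedSpace.1 hpc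
  rw [IsSimplyConnected, simply_connected_iff_loops_nullhomotopic]
  refine ⟨this, fun x γ => ?_⟩
  let c : ∀ y : D, Path.Homotopic.Quotient x y := fun y => .mk (PathConnectedSpace.somePath x y)
  have he := isTriangleCocycle_segmentCocycle c
  obtain ⟨ε, hε, l, hseg, hchain, hprod⟩ := exists_lattice_path c hD γ
  set p := latticeFloor ε x
  obtain ⟨o, ho⟩ : ∃ o : ℤ × ℤ, ∀ y ∈ p :: l, o.1 ≤ y.1 ∧ o.2 ≤ y.2 := by
    obtain ⟨o₁, h₁⟩ := ((p :: l).toFinset.finite_toSet.image Prod.fst).bddBelow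
    obtain ⟨o₂, h₂⟩ := ((p :: l).toFinset.finite_toSet.image Prod.snd).bddBelow
    exact ⟨(o₁, o₂), fun y hy => ⟨h₁ (mem_image_of_mem _ (Finset.mem_coe.2 (List.mem_toFinset.2 hy))),
      h₂ (mem_image_of_mem _ (Finset.mem_coe.2 (List.mem_toFinset.2 hy)))⟩⟩
  rw [chainProd_lattice_eq_one hε hSo hS hDS hDS' he o _ p l rfl ho hchain] at hprod
  refine Path.Homotopic.Quotient.eq.1 (eq_refl_of_pathElt_eq_one c ?_)
  have h1 := he.mul_symm hseg
  -- The two end segments are inverse to each other, so the class of the loop is conjugate to 1.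
  rw [eq_comm, mul_assoc, mul_eq_one_comm, mul_assoc, mul_eq_one_comm.1 h1, mul_one] at hprod
  exact hprod

end

theorem mainTheorem4 (S : Set ℂ) (hSo : IsOpen S) (hSc : IsConnected S) (τ : InfTeich S)
    (D : Set ℂ) (hD : IsComponentOf D (landslideSet τ)) :
    (∀ H : Set ℂ, IsHole H D → ¬ H ⊆ S) ∧ (IsSimplyConnected S → IsSimplyConnected D) := by
  have hholes : ∀ H : Set ℂ, IsHole H D → ¬ H ⊆ S := fun H hH =>
    not_hole_subset_of_component_landslideSet hSo hD hH
  refine ⟨hholes, fun hS => ?_⟩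
  have hleave : HolesLeave D S := fun q hq => by
    by_contra! h
    exact hholes _ ⟨⟨q, hq, rfl⟩, h.1⟩ h.2
  obtain ⟨p, hp, rfl⟩ := hD
  exact isSimplyConnected_of_holesLeave (isOpen_landslideSet τ).connectedComponentIn
    (isConnected_connectedComponentIn_iff.2 hp) hSo hS
    ((connectedComponentIn_subset _ _).trans (landslideSet_subset τ)) hleave
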